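/- **Conventions.** An *arrow diagram* is an oriented circle with finitely many arrows joining points of it, all endpoints being distinct; it is *signed* if each arrow carries a sign $\pm1$. The *Gauss diagram* $G$ of an oriented knot diagram (a closed polygonal curve in the plane whose only multiple points are transverse double points in the interior of edges, with over/under information at each of them) has one arrow for each crossing, running from the passage below to the passage above and carrying the sign of the crossing; a base point on the knot gives a base point on the circle of $G$. For an unsigned arrow diagram $A$ and a Gauss diagram $G$ (with one circle), put $$\mathcal I_A(G)=\langle A,G\rangle=\sum_{\phi\in \mathrm{Hom}(A,G)}\mathrm{sign}(\phi),$$ where $\mathrm{Hom}(A,G)$ is the set of orientation preserving homeomorphisms of the circles that send the arrows of $A$ to arrows of $G$ and preserve their directions, two of them being identified if they agree on the arrows, and $\mathrm{sign}(\phi)$ is the product of the signs of the arrows of $G$ in the image of $\phi$. If $A$ has a base point, $\phi$ is also required to send it to the base point of $G$. **Proposition.** In each of the following two cases $\mathcal I_A(G)=\mathcal I_B(G)$ for every Gauss diagram $G$ of a knot diagram. 1. $A$ and $B$ have three arrows: two disjoint vertical arrows $v,w$, with the same fixed (arbitrary) directions in $A$ and $B$, and a horizontal arrow $h$ that crosses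 both; along the circle one meets $v,h,v,w,h,w$. The arrow $h$ goes from the arc cut off by $v$ to the arc cut off by $w$ in $A$, and in the opposite direction in $B$. 2. $A$ and $B$ have four arrows: three pairwise disjoint arrows $a,b,c$ forming the sides of a triangle (the triangle of a Reidemeister III move), with the same fixed (arbitrary) directions in $A$ and $B$, and a fourth arrow $h$ that crosses $a$ and $b$; along the circle one meets $a,h,a,b,h,b,c,c$. The arrow $h$ goes from the arc cut off by $a$ to the arc cut off by $b$ in $A$, and in the opposite direction in $B$. Both hold for diagrams $A,B$ without base point, and also for diagrams $A,B$ with the same base point, on any arc of the circle that does not lie on one of the two arcs joined by $h$ (the arcs cut off by $v$ and $w$, resp. by $a$ and $b$). -/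

import Mathlib

/-! ### Arrow diagrams on one circle -/

/-- An unsigned arrow diagram on one oriented circle with a base point, with arrows indexed by `ι`.
The circle is cut open at its base point, so that points of the circle other than the base point
are elements of a linear order `P`, increasing in the direction of the circle. All the `2 * #ι`
endpoints of arrows are distinct. -/
structure ArrowDiagram (ι P : Type*) where
  foot : ι → P
  head : ι → P
  injective_ends : Function.Injective (Sum.elim foot head)

/-- A signed arrow diagram: each arrow carries a sign `1` or `-1`. -/
structure SignedArrowDiagram (ι P : Type*) extends ArrowDiagram ι P where
  sign : ι → ℤˣ

/-- The strict cyclic order of three points of a linear order closed up to a circle. -/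
def CyclicLT {P : Type*} [LinearOrder P] (x y z : P) : Prop :=
  (x < y ∧ y < z) ∨ (y < z ∧ z < x) ∨ (z < x ∧ x < y)

namespace ArrowDiagram

/-- The endpoints of the arrows: `Sum.inl a` is the foot of `a`, `Sum.inr a` is its head. -/
def pos {ι P : Type*} (A : ArrowDiagram ι P) : ι ⊕ ι → P := Sum.elim A.foot A.head

/-- `f` is the effect on arrows of an orientation preserving homeomorphism of circles that sends
the arrows of `A` to arrows of `G` and preserves their directions (feet to feet, heads to heads):
it preserves the cyclic order of the endpoints. The base points play no role. Homeomorphisms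
with the same effect on arrows are identified. -/
def IsHom {κ Q ι P : Type*} [LinearOrder Q] [LinearOrder P]
    (A : ArrowDiagram κ Q) (G : ArrowDiagram ι P) (f : κ → ι) : Prop :=
  Function.Injective f ∧ ∀ x y z : κ ⊕ κ, CyclicLT (A.pos x) (A.pos y) (A.pos z) →
    CyclicLT (G.pos (Sum.map f f x)) (G.pos (Sum.map f f y)) (G.pos (Sum.map f f z))

/-- The same for homeomorphisms that also send the base point to the base point: the order in
which the endpoints are met, starting at the base point, is preserved. -/
def IsBasedHom {κ Q ι P : Type*} [LinearOrder Q] [LinearOrder P]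
    (A : ArrowDiagram κ Q) (G : ArrowDiagram ι P) (f : κ → ι) : Prop :=
  Function.Injective f ∧ ∀ x y : κ ⊕ κ, A.pos x < A.pos y →
    G.pos (Sum.map f f x) < G.pos (Sum.map f f y)

open Classical in
/-- The Gauss diagram formula `I_A(G) = ⟨A, G⟩ = ∑_{φ ∈ Hom(A, G)} sign φ` of an unsigned arrow
diagram `A` without base point; `sign φ` is the product of the signs of the arrows of `G` in the
image of `φ`. -/
noncomputable def formula {κ Q ι P : Type*} [Fintype κ] [Fintype ι] [LinearOrder Q] [LinearOrder P]
    (A : ArrowDiagram κ Q) (G : SignedArrowDiagram ι P) : ℤ :=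
  ∑ f ∈ Finset.univ.filter (fun f : κ → ι => A.IsHom G.toArrowDiagram f),
    ∏ a, (G.sign (f a) : ℤ)

open Classical in
/-- The Gauss diagram formula `I_A(G)` of an unsigned arrow diagram `A` with base point. -/
noncomputable def basedFormula {κ Q ι P : Type*} [Fintype κ] [Fintype ι] [LinearOrder Q]
    [LinearOrder P] (A : ArrowDiagram κ Q) (G : SignedArrowDiagram ι P) : ℤ :=
  ∑ f ∈ Finset.univ.filter (fun f : κ → ι => A.IsBasedHom G.toArrowDiagram f),
    ∏ a, (G.sign (f a) : ℤ)

/-- The arrow diagram with arrows between `p a` and `q a`; the arrow `a` goes from `p a` to `q a`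
if `d a = true`, and from `q a` to `p a` if `d a = false`. -/
def ofChords {ι P : Type*} (p q : ι → P) (h : Function.Injective (Sum.elim p q)) (d : ι → Bool) :
    ArrowDiagram ι P where
  foot a := if d a then p a else q a
  head a := if d a then q a else p a
  injective_ends := by
    have h1 : ∀ a b, p a = p b → a = b := fun a b e => by
      simpa using @h (Sum.inl a) (Sum.inl b) (by simpa using e)
    have h2 : ∀ a b, q a = q b → a = b := fun a b e => by
      simpa using @h (Sum.inr a) (Sum.inr b) (by simpa using e)
    have h3 : ∀ a b, p a ≠ q b := fun a b e => by
      simpa using @h (Sum.inl a) (Sum.inr b) (by simpa using e)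
    rintro (a | a) (b | b) e <;> simp only [Sum.elim_inl, Sum.elim_inr] at e
    · congr 1
      split_ifs at e
      exacts [h1 _ _ e, (h3 _ _ e).elim, (h3 _ _ e.symm).elim, h2 _ _ e]
    · exfalso
      split_ifs at e with ha hb hb
      · exact h3 _ _ e
      · have := h1 _ _ e
        subst this
        exact hb ha
      · have := h2 _ _ e
        subst this
        exact ha hb
      · exact h3 _ _ e.symm
    · exfalso
      split_ifs at e with ha hb hb
      · exact h3 _ _ e.symm
      · have := h2 _ _ e
        subst this
        exact hb ha
      · have := h1 _ _ e
        subst this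
        exact ha hb
      · exact h3 _ _ e
    · congr 1
      split_ifs at e
      exacts [h2 _ _ e, (h3 _ _ e.symm).elim, (h3 _ _ e).elim, h1 _ _ e]

/-- Moves the base point of an arrow diagram with endpoints in `{0, …, N}` to the arc that ends
at the endpoint `k`. -/
def rebase {ι : Type*} {N : ℕ} (k : Fin (N + 1)) (A : ArrowDiagram ι (Fin (N + 1))) :
    ArrowDiagram ι (Fin (N + 1)) where
  foot a := A.foot a - k
  head a := A.head a - k
  injective_ends := by
    have : Sum.elim (fun a => A.foot a - k) (fun a => A.head a - k)
        = (fun x => x - k) ∘ Sum.elim A.foot A.head := by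
      ext x; cases x <;> rfl
    rw [this]
    exact (sub_left_injective).comp A.injective_ends

/-- Two disjoint "vertical" arrows and a "horizontal" arrow that crosses both. Along the circle
one meets: the right vertical arrow `0`, the horizontal arrow `2`, the arrow `0`, the left vertical
arrow `1`, the arrow `2`, the arrow `1`. The directions are given by `right`, `left` (`true` if the
arrow starts at the endpoint that is met first), and by `horizontal` (`true` if the horizontal
arrow goes from right to left). -/
def verticalPair (right left horizontal : Bool) : ArrowDiagram (Fin 3) (Fin 6) :=
  ofChords ![0, 3, 1] ![2, 5, 4] (by decide) ![right, left, horizontal]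

/-- Three pairwise disjoint arrows `0`, `1`, `2`, the three sides of a triangle, and a fourth arrow
`3` that crosses the sides `0` and `1` and joins the arc cut off by `0` to the arc cut off by `1`.
Along the circle one meets the arrows in the order `0, 3, 0, 1, 3, 1, 2, 2`. The directions are
given as before; `fourth = true` if the fourth arrow goes from the arc cut off by `0` to the arc
cut off by `1`. -/
def trianglePlus (side₀ side₁ side₂ fourth : Bool) : ArrowDiagram (Fin 4) (Fin 8) :=
  ofChords ![0, 3, 6, 1] ![2, 5, 7, 4] (by decide) ![side₀, side₁, side₂, fourth]

end ArrowDiagram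

/-- Two signed arrow diagrams are equivalent if there is a one-to-one correspondence of the arrows
under which the sequences of feet and heads (from the base point) and the signs coincide. -/
def SignedArrowDiagram.Equivalent {ι P κ Q : Type*} [LinearOrder P] [LinearOrder Q]
    (G : SignedArrowDiagram ι P) (H : SignedArrowDiagram κ Q) : Prop :=
  ∃ e : ι ≃ κ, (∀ x y : ι ⊕ ι, G.pos x < G.pos y ↔ H.pos (Sum.map e e x) < H.pos (Sum.map e e y)) ∧
    ∀ a, H.sign (e a) = G.sign a

/-! ### Knot diagrams and their Gauss diagrams -/

/-- The determinant of two vectors of the oriented plane. -/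
def planeDet (u v : ℝ × ℝ) : ℝ := u.1 * v.2 - u.2 * v.1

/-- A closed oriented polygonal curve in the plane with the vertices `0, 1, …, m`, and the base
point at the vertex `0`. The edge `i` goes from the vertex `i` to the vertex `i + 1`, where
`m + 1 = 0`. -/
structure ClosedPolygon where
  m : ℕ
  vertex : Fin (m + 1) → ℝ × ℝ

namespace ClosedPolygon

/-- The direction vector of the edge `i`. -/
def dir (C : ClosedPolygon) (i : Fin (C.m + 1)) : ℝ × ℝ := C.vertex (i + 1) - C.vertex i

/-- The points of the edge `i`, for `0 ≤ t < 1`. Its last point is the first of the next edge. -/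
def point (C : ClosedPolygon) (i : Fin (C.m + 1)) (t : ℝ) : ℝ × ℝ := C.vertex i + t • C.dir i

/-- The edges `i` and `j` are distinct and have a common point (other than a common vertex of
consecutive edges). -/
def Meets (C : ClosedPolygon) (i j : Fin (C.m + 1)) : Prop :=
  i ≠ j ∧ ∃ s ∈ Set.Ico (0 : ℝ) 1, ∃ t ∈ Set.Ico (0 : ℝ) 1, C.point i s = C.point j t

/-- The parameter on the edge `i` of the intersection with the edge `j`. -/
noncomputable def param (C : ClosedPolygon) (i j : Fin (C.m + 1)) : ℝ :=
  planeDet (C.vertex j - C.vertex i) (C.dir j) / planeDet (C.dir i) (C.dir j)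

end ClosedPolygon

/-- An oriented knot diagram with base point: a closed polygonal curve in the plane whose only
multiple points are transverse double points in the interior of edges, and for each double point
the choice of the strand that passes over the other one. -/
structure KnotDiagram extends ClosedPolygon where
  /-- the edge `i` passes over the edge `j` where they meet -/
  isOver : Fin (m + 1) → Fin (m + 1) → Prop
  vertex_simple : ∀ i j, ∀ t ∈ Set.Ico (0 : ℝ) 1,
    toClosedPolygon.point j t = vertex i → j = i ∧ t = 0
  transverse : ∀ i j, toClosedPolygon.Meets i j →
    planeDet (toClosedPolygon.dir i) (toClosedPolygon.dir j) ≠ 0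
  no_triple : ∀ i j k, i ≠ j → i ≠ k → j ≠ k → ∀ s ∈ Set.Ico (0 : ℝ) 1, ∀ t ∈ Set.Ico (0 : ℝ) 1,
    ∀ u ∈ Set.Ico (0 : ℝ) 1,
    ¬ (toClosedPolygon.point i s = toClosedPolygon.point j t ∧
      toClosedPolygon.point i s = toClosedPolygon.point k u)
  isOver_iff : ∀ i j, toClosedPolygon.Meets i j → (isOver i j ↔ ¬ isOver j i)

namespace KnotDiagram

theorem meets_symm {D : KnotDiagram} {i j : Fin (D.m + 1)} (h : D.Meets i j) : D.Meets j i := by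
  obtain ⟨hij, s, hs, t, ht, e⟩ := h
  exact ⟨hij.symm, t, ht, s, hs, e.symm⟩

theorem param_spec {D : KnotDiagram} {i j : Fin (D.m + 1)} (h : D.Meets i j) :
    D.param i j ∈ Set.Ico (0 : ℝ) 1 ∧ D.point i (D.param i j) = D.point j (D.param j i) := by
  have hd := D.transverse i j h
  have hd' := D.transverse j i (meets_symm h)
  obtain ⟨-, s, hs, t, ht, e⟩ := h
  have e1 := congrArg Prod.fst e
  have e2 := congrArg Prod.snd e
  simp only [ClosedPolygon.point, Prod.fst_add, Prod.snd_add, Prod.smul_fst, Prod.smul_snd,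
    smul_eq_mul] at e1 e2
  have hp : D.param i j = s := by
    rw [ClosedPolygon.param, div_eq_iff hd]
    simp only [planeDet, Prod.fst_sub, Prod.snd_sub]
    linear_combination (D.dir j).1 * e2 - (D.dir j).2 * e1
  have hq : D.param j i = t := by
    rw [ClosedPolygon.param, div_eq_iff hd']
    simp only [planeDet, Prod.fst_sub, Prod.snd_sub]
    linear_combination (D.dir i).2 * e1 - (D.dir i).1 * e2
  rw [hp, hq]
  exact ⟨hs, e⟩

/-- The crossings, as pairs (upper edge, lower edge). Two edges cross at most once. -/
def Crossing (D : KnotDiagram) : Type :=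
  {c : Fin (D.m + 1) × Fin (D.m + 1) // D.Meets c.1 c.2 ∧ D.isOver c.1 c.2}

/-- The position along the knot, from the base point, of the intersection of the edges `i`, `j`,
when it is passed on the edge `i`. -/
noncomputable def position (D : KnotDiagram) (i j : Fin (D.m + 1)) : ℝ := (i : ℕ) + D.param i j

theorem position_inj {D : KnotDiagram} {i j k l : Fin (D.m + 1)} (h : D.Meets i j)
    (h' : D.Meets k l) (e : D.position i j = D.position k l) : i = k ∧ j = l := by
  obtain ⟨h1, h2⟩ := param_spec h
  obtain ⟨h1', h2'⟩ := param_spec h'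
  have hik : i = k := by
    have a : (i : ℕ) = ⌊D.position i j⌋₊ := by
      have hf := Nat.floor_add_natCast h1.1 (i : ℕ)
      rw [Nat.floor_eq_zero.2 h1.2, zero_add, add_comm] at hf
      exact hf.symm
    have b : (k : ℕ) = ⌊D.position k l⌋₊ := by
      have hf := Nat.floor_add_natCast h1'.1 (k : ℕ)
      rw [Nat.floor_eq_zero.2 h1'.2, zero_add, add_comm] at hf
      exact hf.symm
    exact Fin.ext (by rw [a, b, e])
  subst hik
  refine ⟨rfl, ?_⟩
  by_contra hjl
  have hp : D.param i j = D.param i l := by simpa [position] using e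
  exact D.no_triple i j l h.1 h'.1 hjl _ h1 _ (param_spec (meets_symm h)).1 _
    (param_spec (meets_symm h')).1 ⟨h2, by rw [hp]; exact h2'⟩

open Classical in
/-- The Gauss diagram of a knot diagram: one arrow for each crossing, from the passage below (the
foot) to the passage above (the head), with the sign of the crossing, which is `1` if the direction
of the upper strand followed by the direction of the lower strand is a positively oriented basis
of the plane. -/
noncomputable def gaussDiagram (D : KnotDiagram) : SignedArrowDiagram D.Crossing ℝ where
  foot c := D.position c.1.2 c.1.1
  head c := D.position c.1.1 c.1.2
  sign c := if 0 < planeDet (D.dir c.1.1) (D.dir c.1.2) then 1 else -1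
  injective_ends := by
    rintro (⟨⟨i, j⟩, h, o⟩ | ⟨⟨i, j⟩, h, o⟩) (⟨⟨k, l⟩, h', o'⟩ | ⟨⟨k, l⟩, h', o'⟩) e <;>
      simp only [Sum.elim_inl, Sum.elim_inr] at e h h' o o'
    · obtain ⟨rfl, rfl⟩ := position_inj (meets_symm h) (meets_symm h') e
      rfl
    · obtain ⟨rfl, rfl⟩ := position_inj (meets_symm h) h' e
      exact ((D.isOver_iff _ _ h).1 o o').elim
    · obtain ⟨rfl, rfl⟩ := position_inj h (meets_symm h') e
      exact ((D.isOver_iff _ _ h).1 o o').elim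
    · obtain ⟨rfl, rfl⟩ := position_inj h h' e
      rfl

end KnotDiagram

/-- `G` is (equivalent to) the Gauss diagram of a knot diagram. -/
def SignedArrowDiagram.IsGaussDiagram {ι P : Type*} [LinearOrder P]
    (G : SignedArrowDiagram ι P) : Prop :=
  ∃ D : KnotDiagram, G.Equivalent D.gaussDiagram

/-! Fix the images of all arrows but `h`. The two arrows crossed by `h` go to disjoint arrows of
`G`, that is, to two crossings, and the arc cut off by such an arrow leaves a crossing and returns
to it: it is a closed curve in the plane. The possible images of `h`, in `A` and `B` together, are
the crossings of these two loops, and the direction of the arrow tells which loop passes below. An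
arrow has the sign of det(upper, lower), so it contributes minus its sign to the intersection number
of the first loop with the second if it goes from the first to the second, and plus its sign
otherwise. Closed plane curves have intersection number 0, so both directions have the same signed
count (`IsGaussDiagram.sum_joins`); summing over the images of the other arrows gives the theorem
(`IsGaussDiagram.sum_filter_eq`).

The vanishing comes from a discrete Stokes formula. Attach to each segment the half-strip to its
right. As a point moves along another segment, the indicator of the half-strip changes by the
crossings with the segment and with the two horizontal rays bounding the strip
(`segmentIndex_eq_boundary`). Summed over the edges of two arcs, these terms telescope to the ends
of the arcs (`ArcsApart.intersectionNumber_eq`) and cancel when the arcs close up.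

The order conditions for a homomorphism must split into one on the fixed arrows and one placing the
ends of `h` in two arcs (`CyclicLT.chain₆_iff` and the `_iff` lemmas after it). A base point inside
one of these arcs would be compared with an end of `h`, which is why such base points are excluded.
-/

/-! ### Intersection numbers of two segments in the plane. -/

/-- The number (with sign) of intersections of the segment from `x` to `y` with the horizontal ray
to the right of `b`; it is `1` if the segment goes upwards. -/
noncomputable def rayIndex (x y b : ℝ × ℝ) : ℤ :=
  if x.2 < b.2 ∧ b.2 ≤ y.2 ∧ 0 < planeDet (y - x) (b - x) then 1
  else if y.2 < b.2 ∧ b.2 ≤ x.2 ∧ planeDet (y - x) (b - x) < 0 then -1 else 0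

/-- The indicator function (with sign) of the half-strip to the right of the segment from `b`
to `c`, at the point `x`; it is positive if the segment goes upwards. -/
noncomputable def stripIndex (b c x : ℝ × ℝ) : ℤ :=
  if b.2 ≤ x.2 ∧ x.2 < c.2 ∧ planeDet (c - b) (x - b) < 0 then 1
  else if c.2 ≤ x.2 ∧ x.2 < b.2 ∧ 0 < planeDet (c - b) (x - b) then -1 else 0

open Classical in
/-- The intersection number of two segments, from `x` to `y` and from `b` to `c`. -/
noncomputable def segmentIndex (x y b c : ℝ × ℝ) : ℤ :=
  if ∃ s ∈ Set.Icc (0 : ℝ) 1, ∃ t ∈ Set.Icc (0 : ℝ) 1, x + s • (y - x) = b + t • (c - b) then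
    SignType.sign (planeDet (y - x) (c - b)) else 0

theorem rayIndex_swap (x y b : ℝ × ℝ) : rayIndex y x b = -rayIndex x y b := by
  have h : planeDet (x - y) (b - y) = -planeDet (y - x) (b - x) := by
    simp only [planeDet, Prod.fst_sub, Prod.snd_sub]; ring
  unfold rayIndex
  rw [h]
  simp only [Left.neg_pos_iff, Left.neg_neg_iff]
  split_ifs <;> grind

theorem stripIndex_swap (b c x : ℝ × ℝ) : stripIndex c b x = -stripIndex b c x := by
  have h : planeDet (b - c) (x - c) = -planeDet (c - b) (x - b) := by
    simp only [planeDet, Prod.fst_sub, Prod.snd_sub]; ring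
  unfold stripIndex
  rw [h]
  simp only [Left.neg_pos_iff, Left.neg_neg_iff]
  split_ifs <;> grind

theorem segmentIndex_swap_left (x y b c : ℝ × ℝ) :
    segmentIndex y x b c = -segmentIndex x y b c := by
  have h : planeDet (x - y) (c - b) = -planeDet (y - x) (c - b) := by
    simp only [planeDet, Prod.fst_sub, Prod.snd_sub]; ring
  have e : (∃ s ∈ Set.Icc (0 : ℝ) 1, ∃ t ∈ Set.Icc (0 : ℝ) 1, y + s • (x - y) = b + t • (c - b)) ↔
      ∃ s ∈ Set.Icc (0 : ℝ) 1, ∃ t ∈ Set.Icc (0 : ℝ) 1, x + s • (y - x) = b + t • (c - b) := by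
    constructor <;>
    · rintro ⟨s, hs, t, ht, e⟩
      refine ⟨1 - s, ⟨by linarith [hs.2], by linarith [hs.1]⟩, t, ht, ?_⟩
      rw [← e]
      module
  unfold segmentIndex
  rw [h, Left.sign_neg]
  by_cases hm : ∃ s ∈ Set.Icc (0 : ℝ) 1, ∃ t ∈ Set.Icc (0 : ℝ) 1, x + s • (y - x) = b + t • (c - b)
  · rw [if_pos hm, if_pos (e.2 hm)]; simp
  · rw [if_neg hm, if_neg (mt e.1 hm)]; simp

theorem segmentIndex_comm (x y b c : ℝ × ℝ) :
    segmentIndex b c x y = -segmentIndex x y b c := by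
  have h : planeDet (c - b) (y - x) = -planeDet (y - x) (c - b) := by
    simp only [planeDet]; ring
  have e : (∃ s ∈ Set.Icc (0 : ℝ) 1, ∃ t ∈ Set.Icc (0 : ℝ) 1, b + s • (c - b) = x + t • (y - x)) ↔
      ∃ s ∈ Set.Icc (0 : ℝ) 1, ∃ t ∈ Set.Icc (0 : ℝ) 1, x + s • (y - x) = b + t • (c - b) := by
    constructor <;>
    · rintro ⟨s, hs, t, ht, e⟩
      exact ⟨t, ht, s, hs, e.symm⟩
  unfold segmentIndex
  rw [h, Left.sign_neg]
  by_cases hm : ∃ s ∈ Set.Icc (0 : ℝ) 1, ∃ t ∈ Set.Icc (0 : ℝ) 1, x + s • (y - x) = b + t • (c - b)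
  · rw [if_pos hm, if_pos (e.2 hm)]; simp
  · rw [if_neg hm, if_neg (mt e.1 hm)]; simp

theorem segmentIndex_swap_right (x y b c : ℝ × ℝ) :
    segmentIndex x y c b = -segmentIndex x y b c := by
  rw [segmentIndex_comm, segmentIndex_swap_left, segmentIndex_comm x y b c, neg_neg]

/-- The endpoints of each of the segments from `x` to `y` and from `b` to `c` do not lie on the
other one. -/
def EndsApart (x y b c : ℝ × ℝ) : Prop :=
  (∀ t ∈ Set.Icc (0 : ℝ) 1, b + t • (c - b) ≠ x ∧ b + t • (c - b) ≠ y) ∧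
    ∀ s ∈ Set.Icc (0 : ℝ) 1, x + s • (y - x) ≠ b ∧ x + s • (y - x) ≠ c

theorem EndsApart.swap_left {x y b c : ℝ × ℝ} (h : EndsApart x y b c) : EndsApart y x b c := by
  refine ⟨fun t ht => (h.1 t ht).symm, fun s hs => ?_⟩
  have := h.2 (1 - s) ⟨by linarith [hs.2], by linarith [hs.1]⟩
  rwa [show x + (1 - s) • (y - x) = y + s • (x - y) by module] at this

theorem EndsApart.symm {x y b c : ℝ × ℝ} (h : EndsApart x y b c) : EndsApart b c x y := ⟨h.2, h.1⟩

theorem EndsApart.swap_right {x y b c : ℝ × ℝ} (h : EndsApart x y b c) : EndsApart x y c b :=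
  h.symm.swap_left.symm

/-- A point of a line at a height between the heights of two points of the line lies on the segment
between them. -/
theorem exists_eq_add_smul {b c x : ℝ × ℝ} (hb : b.2 ≤ x.2) (hc : x.2 ≤ c.2) (hbc : b.2 < c.2)
    (h : planeDet (c - b) (x - b) = 0) : ∃ t ∈ Set.Icc (0 : ℝ) 1, b + t • (c - b) = x := by
  have hd : c.2 - b.2 ≠ 0 := by linarith
  have hd' : 0 < c.2 - b.2 := by linarith
  refine ⟨(x.2 - b.2) / (c.2 - b.2), ⟨div_nonneg (by linarith) hd'.le, ?_⟩, ?_⟩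
  · rw [div_le_one hd']; linarith
  · simp only [planeDet, Prod.fst_sub, Prod.snd_sub] at h
    ext
    · simp only [Prod.fst_add, Prod.smul_fst, Prod.fst_sub, smul_eq_mul]
      field_simp
      linear_combination h
    · simp only [Prod.snd_add, Prod.smul_snd, Prod.snd_sub, smul_eq_mul]
      field_simp
      ring

/-- Two segments cross exactly when each separates the ends of the other; the four orientation
determinants record this. `EndsApart` makes the separation strict, and parallel segments count 0 on
both sides. -/
theorem segmentIndex_eq {x y b c : ℝ × ℝ} (h : EndsApart x y b c) :
    segmentIndex x y b c =
      if planeDet (y - x) (b - x) < 0 ∧ 0 < planeDet (y - x) (c - x) ∧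
        planeDet (c - b) (y - b) < 0 ∧ 0 < planeDet (c - b) (x - b) then 1
      else if planeDet (y - x) (c - x) < 0 ∧ 0 < planeDet (y - x) (b - x) ∧
        planeDet (c - b) (x - b) < 0 ∧ 0 < planeDet (c - b) (y - b) then -1 else 0 := by
  set D₁ := planeDet (y - x) (b - x) with h₁
  set D₂ := planeDet (y - x) (c - x) with h₂
  set D₃ := planeDet (c - b) (x - b) with h₃
  set D₄ := planeDet (c - b) (y - b) with h₄
  have hΔ : planeDet (y - x) (c - b) = D₂ - D₁ := by
    simp only [h₁, h₂, planeDet, Prod.fst_sub, Prod.snd_sub]; ring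
  have hΔ' : planeDet (y - x) (c - b) = D₃ - D₄ := by
    simp only [h₃, h₄, planeDet, Prod.fst_sub, Prod.snd_sub]; ring
  unfold segmentIndex
  set Δ := planeDet (y - x) (c - b) with hΔ₀
  by_cases hm : ∃ s ∈ Set.Icc (0 : ℝ) 1, ∃ t ∈ Set.Icc (0 : ℝ) 1, x + s • (y - x) = b + t • (c - b)
  · rw [if_pos hm]
    obtain ⟨s, hs, t, ht, e⟩ := hm
    have hs0 : s ≠ 0 := by
      rintro rfl; exact (h.1 t ht).1 (by rw [← e]; module)
    have hs1 : s ≠ 1 := by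
      rintro rfl; exact (h.1 t ht).2 (by rw [← e]; module)
    have ht0 : t ≠ 0 := by
      rintro rfl; exact (h.2 s hs).1 (by rw [e]; module)
    have ht1 : t ≠ 1 := by
      rintro rfl; exact (h.2 s hs).2 (by rw [e]; module)
    have hs0' := lt_of_le_of_ne hs.1 hs0.symm
    have hs1' := lt_of_le_of_ne hs.2 hs1
    have ht0' := lt_of_le_of_ne ht.1 ht0.symm
    have ht1' := lt_of_le_of_ne ht.2 ht1
    have e1 := congrArg Prod.fst e
    have e2 := congrArg Prod.snd e
    simp only [Prod.fst_add, Prod.snd_add, Prod.smul_fst, Prod.smul_snd, Prod.fst_sub,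
      Prod.snd_sub, smul_eq_mul] at e1 e2
    have k₁ : D₁ = -(t * Δ) := by
      simp only [h₁, hΔ₀, planeDet, Prod.fst_sub, Prod.snd_sub]
      linear_combination (y.2 - x.2) * e1 - (y.1 - x.1) * e2
    have k₃ : D₃ = s * Δ := by
      simp only [h₃, hΔ₀, planeDet, Prod.fst_sub, Prod.snd_sub]
      linear_combination (c.1 - b.1) * e2 - (c.2 - b.2) * e1
    have k₂ : D₂ = (1 - t) * Δ := by linear_combination k₁ - hΔ
    have k₄ : D₄ = -((1 - s) * Δ) := by linear_combination k₃ + hΔ'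
    rcases lt_trichotomy Δ 0 with hn | hz | hp
    · have l₁ : 0 < D₁ := by rw [k₁]; nlinarith
      have l₂ : D₂ < 0 := by rw [k₂]; nlinarith
      have l₃ : D₃ < 0 := by rw [k₃]; nlinarith
      have l₄ : 0 < D₄ := by rw [k₄]; nlinarith
      rw [sign_neg hn, if_neg (by rintro ⟨a, -⟩; linarith), if_pos ⟨l₂, l₁, l₃, l₄⟩]
      rfl
    · rw [hz] at k₁ k₂
      simp [hz, k₁, k₂]
    · have l₁ : D₁ < 0 := by rw [k₁]; nlinarith
      have l₂ : 0 < D₂ := by rw [k₂]; nlinarith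
      have l₃ : 0 < D₃ := by rw [k₃]; nlinarith
      have l₄ : D₄ < 0 := by rw [k₄]; nlinarith
      rw [sign_pos hp, if_pos ⟨l₁, l₂, l₄, l₃⟩]
      rfl
  · rw [if_neg hm]
    -- Cramer's rule: these are the parameters of the intersection of the two lines.
    have key : Δ ≠ 0 → D₃ / Δ ∈ Set.Icc (0 : ℝ) 1 → -D₁ / Δ ∈ Set.Icc (0 : ℝ) 1 → False := by
      intro h0 hs ht
      refine hm ⟨_, hs, _, ht, ?_⟩
      ext
      · simp only [Prod.fst_add, Prod.smul_fst, Prod.fst_sub, smul_eq_mul]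
        field_simp
        simp only [h₁, h₃, hΔ₀, planeDet, Prod.fst_sub, Prod.snd_sub]
        ring
      · simp only [Prod.snd_add, Prod.smul_snd, Prod.snd_sub, smul_eq_mul]
        field_simp
        simp only [h₁, h₃, hΔ₀, planeDet, Prod.fst_sub, Prod.snd_sub]
        ring
    rw [if_neg, if_neg]
    · rintro ⟨l₂, l₁, l₃, l₄⟩
      have hn : Δ < 0 := by linarith
      refine key hn.ne ⟨div_nonneg_of_nonpos l₃.le hn.le, (div_le_one_of_neg hn).2 (by linarith)⟩
        ⟨div_nonneg_of_nonpos (by linarith) hn.le, (div_le_one_of_neg hn).2 (by linarith)⟩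
    · rintro ⟨l₁, l₂, l₄, l₃⟩
      have hp : 0 < Δ := by linarith
      refine key hp.ne' ⟨div_nonneg l₃.le hp.le, (div_le_one hp).2 (by linarith)⟩
        ⟨div_nonneg (by linarith) hp.le, (div_le_one hp).2 (by linarith)⟩

/-- A point of a horizontal line lies on the segment between two points of the line that are seen
on different sides. -/
theorem exists_eq_add_smul_of_horizontal {b c x y : ℝ × ℝ} (hb : b.2 = y.2) (hc : c.2 = y.2)
    (h : planeDet (y - x) (b - x) * planeDet (y - x) (c - x) < 0) :
    ∃ t ∈ Set.Icc (0 : ℝ) 1, b + t • (c - b) = y := by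
  simp only [planeDet, Prod.fst_sub, Prod.snd_sub, hb, hc] at h
  have h' : (y.2 - x.2) ^ 2 * ((y.1 - b.1) * (y.1 - c.1)) < 0 := by linarith
  have h'' : (y.1 - b.1) * (y.1 - c.1) < 0 := by
    by_contra! k
    nlinarith [mul_nonneg (sq_nonneg (y.2 - x.2)) k]
  have hd : c.1 - b.1 ≠ 0 := fun k => by
    rw [show c.1 = b.1 by linarith] at h''
    nlinarith
  refine ⟨(y.1 - b.1) / (c.1 - b.1), ?_, ?_⟩
  · rcases mul_neg_iff.1 h'' with ⟨k₁, k₂⟩ | ⟨k₁, k₂⟩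
    · exact ⟨div_nonneg k₁.le (by linarith), (div_le_one (by linarith)).2 (by linarith)⟩
    · exact ⟨div_nonneg_of_nonpos k₁.le (by linarith),
        (div_le_one_of_neg (by linarith)).2 (by linarith)⟩
  · ext
    · simp only [Prod.fst_add, Prod.smul_fst, Prod.fst_sub, smul_eq_mul]
      field_simp
      ring
    · simp only [Prod.snd_add, Prod.smul_snd, Prod.snd_sub, smul_eq_mul, hb, hc]
      ring

/-- The ties in `stripIndex` and `rayIndex` all follow one rule: a point `x` or `y` level with `b`
or `c` counts as above it. Hence no general position of heights is needed, and horizontal or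
degenerate segments are allowed. -/
theorem segmentIndex_eq_boundary_of_le {x y b c : ℝ × ℝ} (h : EndsApart x y b c)
    (hxy : x.2 ≤ y.2) (hbc : b.2 ≤ c.2) :
    segmentIndex x y b c =
      stripIndex b c y - stripIndex b c x + rayIndex x y c - rayIndex x y b := by
  -- An endpoint within the height range of the other segment is off its line, by `EndsApart`. The
  -- bounds `n₅` and `n₆` do the same for a horizontal segment level with an endpoint of the other.
  have n₁ : x.2 < b.2 → b.2 ≤ y.2 → planeDet (y - x) (b - x) ≠ 0 := fun k₁ k₂ k₃ => by
    obtain ⟨t, ht, e⟩ := exists_eq_add_smul k₁.le k₂ (by linarith) k₃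
    exact (h.2 t ht).1 e
  have n₂ : x.2 < c.2 → c.2 ≤ y.2 → planeDet (y - x) (c - x) ≠ 0 := fun k₁ k₂ k₃ => by
    obtain ⟨t, ht, e⟩ := exists_eq_add_smul k₁.le k₂ (by linarith) k₃
    exact (h.2 t ht).2 e
  have n₃ : b.2 ≤ x.2 → x.2 < c.2 → planeDet (c - b) (x - b) ≠ 0 := fun k₁ k₂ k₃ => by
    obtain ⟨t, ht, e⟩ := exists_eq_add_smul k₁ k₂.le (by linarith) k₃
    exact (h.1 t ht).1 e
  have n₄ : b.2 ≤ y.2 → y.2 < c.2 → planeDet (c - b) (y - b) ≠ 0 := fun k₁ k₂ k₃ => by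
    obtain ⟨t, ht, e⟩ := exists_eq_add_smul k₁ k₂.le (by linarith) k₃
    exact (h.1 t ht).2 e
  have n₅ : b.2 = y.2 → c.2 = y.2 → 0 ≤ planeDet (y - x) (b - x) * planeDet (y - x) (c - x) :=
    fun k₁ k₂ => by
      by_contra! k₃
      obtain ⟨t, ht, e⟩ := exists_eq_add_smul_of_horizontal k₁ k₂ k₃
      exact (h.1 t ht).2 e
  have n₆ : x.2 = b.2 → y.2 = b.2 → 0 ≤ planeDet (c - b) (x - b) * planeDet (c - b) (y - b) :=
    fun k₁ k₂ => by
      by_contra! k₃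
      have e' (z : ℝ × ℝ) : planeDet (b - c) (z - c) = -planeDet (c - b) (z - b) := by
        simp only [planeDet, Prod.fst_sub, Prod.snd_sub]; ring
      obtain ⟨t, ht, e⟩ := exists_eq_add_smul_of_horizontal (x := c) k₁ k₂
        (by rw [e', e', neg_mul_neg]; exact k₃)
      exact (h.2 t ht).1 e
  rw [segmentIndex_eq h]
  unfold stripIndex rayIndex
  have hz : x.2 = y.2 → x.2 = b.2 → planeDet (y - x) (b - x) = 0 := fun k₁ k₂ => by
    simp only [planeDet, Prod.fst_sub, Prod.snd_sub, ← k₁, ← k₂]; ring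
  have hsum : planeDet (y - x) (c - x) - planeDet (y - x) (b - x) =
      planeDet (c - b) (x - b) - planeDet (c - b) (y - b) := by
    simp only [planeDet, Prod.fst_sub, Prod.snd_sub]; ring
  -- Together with `hsum` this is the affine dependence of the four points, read off on heights.
  -- Measuring heights from one of the points eliminates one determinant, which gives `rb`, `rx`,
  -- `rc`, `ry`. What remains is sign bookkeeping over the relative heights.
  have hrel : planeDet (c - b) (x - b) * y.2 - planeDet (c - b) (y - b) * x.2 +
      planeDet (y - x) (b - x) * c.2 - planeDet (y - x) (c - x) * b.2 = 0 := by
    simp only [planeDet, Prod.fst_sub, Prod.snd_sub]; ring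
  generalize planeDet (y - x) (b - x) = D₁ at *
  generalize planeDet (y - x) (c - x) = D₂ at *
  generalize planeDet (c - b) (x - b) = D₃ at *
  generalize planeDet (c - b) (y - b) = D₄ at *
  generalize x.2 = x at *
  generalize y.2 = y at *
  generalize b.2 = b at *
  generalize c.2 = c at *
  clear h
  have rb : D₃ * (y - b) + D₄ * (b - x) + D₁ * (c - b) = 0 := by
    linear_combination hrel + b * hsum
  have rx : D₃ * (y - x) + D₁ * (c - x) + D₂ * (x - b) = 0 := by
    linear_combination hrel + x * hsum
  have rc : D₃ * (y - c) + D₄ * (c - x) + D₂ * (c - b) = 0 := by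
    linear_combination hrel + c * hsum
  have ry : D₄ * (y - x) + D₁ * (c - y) + D₂ * (y - b) = 0 := by
    linear_combination hrel + y * hsum
  clear hrel
  rcases lt_or_ge x b with hxb | hxb
  · rcases lt_or_ge y b with hyb | hyb
    · have : ¬ (D₁ < 0 ∧ 0 < D₂ ∧ D₄ < 0 ∧ 0 < D₃) := by
        rintro ⟨l₁, l₂, l₃, l₄⟩
        nlinarith [mul_pos l₄ (sub_pos.2 hyb), mul_pos_of_neg_of_neg l₃ (sub_neg.2 hxb),
          mul_nonneg (neg_nonneg.2 l₁.le) (sub_nonneg.2 hbc)]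
      have : ¬ (D₂ < 0 ∧ 0 < D₁ ∧ D₃ < 0 ∧ 0 < D₄) := by
        rintro ⟨l₁, l₂, l₃, l₄⟩
        nlinarith [mul_pos l₄ (sub_pos.2 hxb), mul_pos_of_neg_of_neg l₃ (sub_neg.2 hyb),
          mul_nonneg l₂.le (sub_nonneg.2 hbc)]
      clear rb rx rc ry hsum n₅ n₆ hz
      grind
    · rcases lt_or_ge y c with hyc | hyc
      · have k₁ := n₁ hxb hyb
        have k₄ := n₄ hyb hyc
        have : D₄ < 0 → D₁ < 0 → 0 < D₃ ∧ 0 < D₂ := fun l₄ l₁ =>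
          ⟨by by_contra! l; nlinarith, by by_contra! l; nlinarith⟩
        have : 0 < D₄ → 0 < D₁ → D₃ < 0 ∧ D₂ < 0 := fun l₄ l₁ =>
          ⟨by by_contra! l; nlinarith, by by_contra! l; nlinarith⟩
        clear rb rx rc ry hsum n₅ n₆ hz n₁ n₂ n₃ n₄
        grind
      · have k₁ := n₁ hxb hyb
        have k₂ := n₂ (by linarith) hyc
        have : D₁ < 0 → 0 < D₂ → D₄ < 0 ∧ 0 < D₃ := fun l₁ l₂ => by
          refine ⟨?_, by by_contra! l; nlinarith⟩
          rcases hyb.lt_or_eq with e | e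
          · by_contra! l; nlinarith
          · have := n₅ e (by linarith)
            nlinarith
        have : 0 < D₁ → D₂ < 0 → 0 < D₄ ∧ D₃ < 0 := fun l₁ l₂ => by
          refine ⟨?_, by by_contra! l; nlinarith⟩
          rcases hyb.lt_or_eq with e | e
          · by_contra! l; nlinarith
          · have := n₅ e (by linarith)
            nlinarith
        clear rb rx rc ry hsum n₅ n₆ hz n₁ n₂ n₃ n₄
        grind
  · rcases lt_or_ge x c with hxc | hxc
    · rcases lt_or_ge y c with hyc | hyc
      · have k₃ := n₃ hxb hxc
        have k₄ := n₄ (by linarith) hyc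
        have : D₄ < 0 → 0 < D₃ → D₁ < 0 ∧ 0 < D₂ := fun l₄ l₃ => by
          refine ⟨?_, by by_contra! l; nlinarith⟩
          rcases (hxb.trans hxy).lt_or_eq with e | e
          · by_contra! l; nlinarith
          · have := n₆ (by linarith) e.symm
            nlinarith
        have : 0 < D₄ → D₃ < 0 → 0 < D₁ ∧ D₂ < 0 := fun l₄ l₃ => by
          refine ⟨?_, by by_contra! l; nlinarith⟩
          rcases (hxb.trans hxy).lt_or_eq with e | e
          · by_contra! l; nlinarith
          · have := n₆ (by linarith) e.symm
            nlinarith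
        clear rb rx rc ry hsum n₅ n₆ hz n₁ n₂ n₃ n₄
        grind
      · have k₃ := n₃ hxb hxc
        have k₂ := n₂ hxc hyc
        have : D₃ < 0 → D₂ < 0 → 0 < D₁ ∧ 0 < D₄ := fun l₃ l₂ =>
          ⟨by by_contra! l; nlinarith, by by_contra! l; nlinarith⟩
        have : 0 < D₃ → 0 < D₂ → D₁ < 0 ∧ D₄ < 0 := fun l₃ l₂ =>
          ⟨by by_contra! l; nlinarith, by by_contra! l; nlinarith⟩
        clear rb rx rc ry hsum n₅ n₆ hz n₁ n₂ n₃ n₄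
        grind
    -- Here all boundary terms vanish, so a crossing must be excluded. It would make every term of
    -- `rx` of one weak sign; `hne` makes one of them strict.
    · have hne : D₁ ≠ 0 → x < y ∨ b < x := fun k => by
        by_contra! l
        exact k (hz (by linarith) (by linarith))
      have : ¬ (D₁ < 0 ∧ 0 < D₂ ∧ D₄ < 0 ∧ 0 < D₃) := by
        rintro ⟨l₁, l₂, l₃, l₄⟩
        have p₁ := mul_nonneg l₄.le (sub_nonneg.2 hxy)
        have p₂ := mul_nonneg l₂.le (sub_nonneg.2 hxb)
        have p₃ := mul_nonneg (neg_nonneg.2 l₁.le) (sub_nonneg.2 hxc)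
        rcases hne l₁.ne with k | k
        · nlinarith [mul_pos l₄ (sub_pos.2 k)]
        · nlinarith [mul_pos l₂ (sub_pos.2 k)]
      have : ¬ (D₂ < 0 ∧ 0 < D₁ ∧ D₃ < 0 ∧ 0 < D₄) := by
        rintro ⟨l₁, l₂, l₃, l₄⟩
        have p₁ := mul_nonneg (neg_nonneg.2 l₃.le) (sub_nonneg.2 hxy)
        have p₂ := mul_nonneg (neg_nonneg.2 l₁.le) (sub_nonneg.2 hxb)
        have p₃ := mul_nonneg l₂.le (sub_nonneg.2 hxc)
        rcases hne l₂.ne' with k | k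
        · nlinarith [mul_pos_of_neg_of_neg l₃ (sub_neg.2 k)]
        · nlinarith [mul_pos_of_neg_of_neg l₁ (sub_neg.2 k)]
      clear rb rx rc ry hsum n₅ n₆ hz
      grind

/-- The intersection number of two segments is the sum of contributions of the endpoints of both
segments. -/
theorem segmentIndex_eq_boundary {x y b c : ℝ × ℝ} (h : EndsApart x y b c) :
    segmentIndex x y b c =
      stripIndex b c y - stripIndex b c x + rayIndex x y c - rayIndex x y b := by
  -- Reversing either segment changes the sign of both sides, so both may be taken to point upwards.
  rcases le_total x.2 y.2 with hxy | hxy <;> rcases le_total b.2 c.2 with hbc | hbc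
  · exact segmentIndex_eq_boundary_of_le h hxy hbc
  · have := segmentIndex_eq_boundary_of_le h.swap_right hxy hbc
    rw [segmentIndex_swap_right, stripIndex_swap b c, stripIndex_swap b c] at this
    linarith
  · have := segmentIndex_eq_boundary_of_le h.swap_left hxy hbc
    rw [segmentIndex_swap_left, rayIndex_swap x y, rayIndex_swap x y] at this
    linarith
  · have := segmentIndex_eq_boundary_of_le h.swap_left.swap_right hxy hbc
    rw [segmentIndex_swap_right, segmentIndex_swap_left, stripIndex_swap b c, stripIndex_swap b c,
      rayIndex_swap x y, rayIndex_swap x y] at this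
    linarith

/-! ### The knot as a parametrized curve and its double points. -/

namespace KnotDiagram

/-- The parametrization of the knot diagram on `[0, m + 1]` that is affine on the edges. -/
noncomputable def curve (D : KnotDiagram) (p : ℝ) : ℝ × ℝ :=
  D.point (Fin.ofNat (D.m + 1) ⌊p⌋₊) (p - ⌊p⌋₊)

theorem curve_eq_point {D : KnotDiagram} (i : Fin (D.m + 1)) {p : ℝ} (h₀ : ((i : ℕ) : ℝ) ≤ p)
    (h₁ : p ≤ (i : ℕ) + 1) : D.curve p = D.point i (p - (i : ℕ)) := by
  rcases h₁.lt_or_eq with h | rfl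
  · have hf : ⌊p⌋₊ = (i : ℕ) := (Nat.floor_eq_iff ((Nat.cast_nonneg _).trans h₀)).2 ⟨h₀, h⟩
    rw [curve, hf]
    congr 1
    exact Fin.ext (by simp)
  -- At the last point of an edge the floor selects the next edge at parameter 0; `Fin.ofNat` wraps
  -- around after the last edge, so the curve closes up.
  · have hf : ⌊((i : ℕ) : ℝ) + 1⌋₊ = (i : ℕ) + 1 := by
      exact_mod_cast Nat.floor_natCast ((i : ℕ) + 1)
    have hi : Fin.ofNat (D.m + 1) ((i : ℕ) + 1) = i + 1 := by
      apply Fin.ext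
      simp [Fin.val_add]
    rw [curve, hf, hi]
    simp only [ClosedPolygon.point, ClosedPolygon.dir]
    push_cast
    module

theorem curve_zero (D : KnotDiagram) : D.curve 0 = D.vertex 0 := by
  rw [curve_eq_point (0 : Fin (D.m + 1)) (by simp) (by simp)]
  simp [ClosedPolygon.point]

theorem curve_length (D : KnotDiagram) : D.curve ((D.m + 1 : ℕ) : ℝ) = D.curve 0 := by
  rw [curve_zero, curve_eq_point (Fin.last D.m) (by simp) (by simp)]
  simp [ClosedPolygon.point, ClosedPolygon.dir]

theorem exists_edge {D : KnotDiagram} {p : ℝ} (h₀ : 0 ≤ p) (h₁ : p < (D.m + 1 : ℕ)) :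
    ∃ i : Fin (D.m + 1), ((i : ℕ) : ℝ) ≤ p ∧ p < (i : ℕ) + 1 :=
  ⟨⟨⌊p⌋₊, (Nat.floor_lt h₀).2 h₁⟩, Nat.floor_le h₀, Nat.lt_floor_add_one p⟩

theorem param_eq_of_point_eq {D : KnotDiagram} {i j : Fin (D.m + 1)} (h : D.Meets i j) {s t : ℝ}
    (e : D.point i s = D.point j t) : D.param i j = s := by
  have e1 := congrArg Prod.fst e
  have e2 := congrArg Prod.snd e
  simp only [ClosedPolygon.point, Prod.fst_add, Prod.snd_add, Prod.smul_fst, Prod.smul_snd,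
    smul_eq_mul] at e1 e2
  rw [ClosedPolygon.param, div_eq_iff (D.transverse i j h)]
  simp only [planeDet, Prod.fst_sub, Prod.snd_sub]
  linear_combination (D.dir j).1 * e2 - (D.dir j).2 * e1

/-- On a degenerate edge the midpoint would equal the initial vertex, against `vertex_simple`. -/
theorem dir_ne_zero (D : KnotDiagram) (i : Fin (D.m + 1)) : D.dir i ≠ 0 := fun h => by
  have := (D.vertex_simple i i (1 / 2) (by constructor <;> norm_num)
    (by simp [ClosedPolygon.point, h])).2
  norm_num at this

/-- A vertex lies on no other edge, so crossings are interior to edges. Their positions are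
therefore never integers, and never the base point. -/
theorem param_pos {D : KnotDiagram} {i j : Fin (D.m + 1)} (h : D.Meets i j) :
    0 < D.param i j := by
  refine lt_of_le_of_ne (param_spec h).1.1 fun e => h.1 ?_
  have := (param_spec h).2
  rw [← e] at this
  exact (D.vertex_simple i j _ (param_spec (meets_symm h)).1
    (by rw [← this]; simp [ClosedPolygon.point])).1.symm

theorem lt_position {D : KnotDiagram} {i j : Fin (D.m + 1)} (h : D.Meets i j) :
    ((i : ℕ) : ℝ) < D.position i j := by
  have := param_pos h
  simp only [position]; linarith

theorem position_lt {D : KnotDiagram} {i j : Fin (D.m + 1)} (h : D.Meets i j) :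
    D.position i j < (i : ℕ) + 1 := by
  have := (param_spec h).1.2
  simp only [position]; linarith

theorem position_pos {D : KnotDiagram} {i j : Fin (D.m + 1)} (h : D.Meets i j) :
    0 < D.position i j := (Nat.cast_nonneg _).trans_lt (lt_position h)

theorem position_lt_length {D : KnotDiagram} {i j : Fin (D.m + 1)} (h : D.Meets i j) :
    D.position i j < (D.m + 1 : ℕ) :=
  (position_lt h).trans_le (by exact_mod_cast i.2)

theorem position_ne_natCast {D : KnotDiagram} {i j : Fin (D.m + 1)} (h : D.Meets i j) (n : ℕ) :
    D.position i j ≠ n := fun e => by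
  have h₁ := lt_position h
  have h₂ := position_lt h
  rw [e] at h₁ h₂
  norm_cast at h₁ h₂
  omega

theorem curve_position {D : KnotDiagram} {i j : Fin (D.m + 1)} (h : D.Meets i j) :
    D.curve (D.position i j) = D.curve (D.position j i) := by
  rw [curve_eq_point i (lt_position h).le (position_lt h).le,
    curve_eq_point j (lt_position (meets_symm h)).le (position_lt (meets_symm h)).le]
  simpa [position] using (param_spec h).2

/-- The curve passes twice only through the crossings, apart from its start. -/
theorem eq_or_meets_of_curve_eq {D : KnotDiagram} {p q : ℝ} (hp₀ : 0 ≤ p)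
    (hp₁ : p < (D.m + 1 : ℕ)) (hq₀ : 0 ≤ q) (hq₁ : q < (D.m + 1 : ℕ))
    (h : D.curve p = D.curve q) :
    p = q ∨ ∃ i j, D.Meets i j ∧ p = D.position i j ∧ q = D.position j i := by
  obtain ⟨i, hi, hi'⟩ := exists_edge hp₀ hp₁
  obtain ⟨j, hj, hj'⟩ := exists_edge hq₀ hq₁
  rw [curve_eq_point i hi hi'.le, curve_eq_point j hj hj'.le] at h
  by_cases hij : i = j
  · subst hij
    left
    simp only [ClosedPolygon.point, add_right_inj] at h
    have := smul_left_injective ℝ (D.dir_ne_zero i) h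
    linarith
  · right
    have hm : D.Meets i j := ⟨hij, _, ⟨by linarith, by linarith⟩, _, ⟨by linarith, by linarith⟩, h⟩
    refine ⟨i, j, hm, ?_, ?_⟩
    · rw [position, param_eq_of_point_eq hm h]; ring
    · rw [position, param_eq_of_point_eq (meets_symm hm) h.symm]; ring

theorem eq_zero_or_length_of_curve_eq {D : KnotDiagram} {q : ℝ} (hq₀ : 0 ≤ q)
    (hq₁ : q ≤ (D.m + 1 : ℕ)) (h : D.curve 0 = D.curve q) : q = 0 ∨ q = (D.m + 1 : ℕ) := by
  rcases hq₁.lt_or_eq with hq | hq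
  · rcases eq_or_meets_of_curve_eq le_rfl (by positivity) hq₀ hq h with e | ⟨i, j, hm, e, -⟩
    · exact Or.inl e.symm
    · exact absurd e.symm (by exact_mod_cast position_ne_natCast hm 0)
  · exact Or.inr hq

theorem eq_position_of_curve_eq {D : KnotDiagram} {i j : Fin (D.m + 1)} (hm : D.Meets i j) {q : ℝ}
    (hq₀ : 0 ≤ q) (hq₁ : q ≤ (D.m + 1 : ℕ)) (h : D.curve (D.position i j) = D.curve q) :
    q = D.position i j ∨ q = D.position j i := by
  have key : q < (D.m + 1 : ℕ) → q = D.position i j ∨ q = D.position j i := fun hq => by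
    rcases eq_or_meets_of_curve_eq (position_pos hm).le (position_lt_length hm) hq₀ hq h
      with e | ⟨k, l, hm', e, e'⟩
    · exact Or.inl e.symm
    · obtain ⟨rfl, rfl⟩ := position_inj hm hm' e
      exact Or.inr e'
  rcases hq₁.lt_or_eq with hq | rfl
  · exact key hq
  -- The end of the parameter interval is the base point again, which is no crossing.
  · rw [curve_length] at h
    rcases eq_zero_or_length_of_curve_eq (position_pos hm).le (position_lt_length hm).le h.symm
      with e | e
    · exact absurd e (position_pos hm).ne'
    · exact absurd e (position_lt_length hm).ne

/-! ### Arcs of the curve, cut out edge by edge. -/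

/-- The point of the interval `[u, v]` closest to `t`. -/
noncomputable def cut (u v t : ℝ) : ℝ := max u (min t v)

theorem cut_mem {u v : ℝ} (h : u ≤ v) (t : ℝ) : cut u v t ∈ Set.Icc u v :=
  ⟨le_max_left _ _, max_le h (min_le_right _ _)⟩

theorem cut_eq (u v t : ℝ) : cut u v t = u ∨ cut u v t = v ∨ cut u v t = t := by
  unfold cut
  rcases max_choice u (min t v) with h | h <;> rw [h]
  · exact Or.inl rfl
  · rcases min_choice t v with h | h <;> simp [h]

/-- Clamping the ends of the edge `[t, t + 1]` to `[u, v]` either collapses it to a point or leaves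
a genuine subinterval. An arc is thus always a chain of `m + 1` segments, some degenerate, and sums
can run over all edges wherever `u` and `v` lie. -/
theorem cut_cases {u v : ℝ} (h : u ≤ v) (t : ℝ) :
    (cut u v t = cut u v (t + 1) ∧ ∀ p, t < p → p < t + 1 → ¬ (u < p ∧ p < v)) ∨
    (t ≤ cut u v t ∧ cut u v t < cut u v (t + 1) ∧ cut u v (t + 1) ≤ t + 1 ∧
      ∀ p, t < p → p < t + 1 → u < p → p < v → cut u v t < p ∧ p < cut u v (t + 1)) := by
  unfold cut
  rcases le_or_gt (t + 1) u with h₁ | h₁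
  · refine Or.inl ⟨?_, fun p _ h₂ h₃ => by linarith [h₃.1]⟩
    rw [min_eq_left (by linarith), min_eq_left (by linarith), max_eq_left (by linarith),
      max_eq_left h₁]
  rcases le_or_gt v t with h₂ | h₂
  · refine Or.inl ⟨?_, fun p h₃ _ h₄ => by linarith [h₄.2]⟩
    rw [min_eq_right h₂, min_eq_right (by linarith)]
  rw [min_eq_left h₂.le, max_eq_right (le_min h₁.le h)]
  rcases h.eq_or_lt with rfl | h₃
  · refine Or.inl ⟨?_, fun p _ _ h₄ => by linarith [h₄.1, h₄.2]⟩
    rw [max_eq_left h₂.le, min_eq_right h₁.le]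
  · exact Or.inr ⟨le_max_right _ _, lt_min (max_lt h₁ (lt_add_one t)) (max_lt h₃ h₂),
      min_le_left _ _, fun p k₁ k₂ k₃ k₄ => ⟨max_lt k₃ k₁, lt_min k₂ k₄⟩⟩

/-- The points of the part of the curve over `[u, v]` on one edge. -/
theorem exists_curve_eq {D : KnotDiagram} {u v : ℝ} (huv : u ≤ v) (i : Fin (D.m + 1)) {t : ℝ}
    (ht : t ∈ Set.Icc (0 : ℝ) 1) :
    D.curve (cut u v (i : ℕ)) + t • (D.curve (cut u v ((i : ℕ) + 1)) - D.curve (cut u v (i : ℕ))) =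
      D.curve (cut u v (i : ℕ) + t * (cut u v ((i : ℕ) + 1) - cut u v (i : ℕ))) ∧
    cut u v (i : ℕ) + t * (cut u v ((i : ℕ) + 1) - cut u v (i : ℕ)) ∈ Set.Icc u v := by
  obtain ⟨ha, ha'⟩ := cut_mem huv (i : ℕ)
  obtain ⟨hb, hb'⟩ := cut_mem huv ((i : ℕ) + 1)
  rcases cut_cases huv (i : ℕ) with ⟨h, -⟩ | ⟨h₁, h₂, h₃, -⟩
  · rw [← h, sub_self, sub_self, smul_zero, mul_zero, add_zero, add_zero]
    exact ⟨rfl, ha, ha'⟩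
  · generalize cut u v (i : ℕ) = a at *
    generalize cut u v ((i : ℕ) + 1) = b at *
    have k₁ : 0 ≤ t * (b - a) := mul_nonneg ht.1 (by linarith)
    have k₂ : t * (b - a) ≤ b - a := mul_le_of_le_one_left (by linarith) ht.2
    refine ⟨?_, by linarith, by linarith⟩
    rw [curve_eq_point i h₁ (by linarith), curve_eq_point i (by linarith) h₃,
      curve_eq_point i (p := a + t * (b - a)) (by linarith) (by linarith)]
    simp only [ClosedPolygon.point]
    module

/-- The arcs of the curve over the intervals `[u, v]` and `[u', v']` meet neither at their ends
nor at vertices. -/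
def ArcsApart (D : KnotDiagram) (u v u' v' : ℝ) : Prop :=
  ∀ p ∈ Set.Icc u v, ∀ q ∈ Set.Icc u' v', D.curve p = D.curve q →
    (p ≠ u ∧ p ≠ v ∧ ∀ n : ℕ, p ≠ n) ∧ (q ≠ u' ∧ q ≠ v' ∧ ∀ n : ℕ, q ≠ n)

theorem ArcsApart.symm {D : KnotDiagram} {u v u' v' : ℝ} (h : D.ArcsApart u v u' v') :
    D.ArcsApart u' v' u v := fun p hp q hq e => (h q hq p hp e.symm).symm

theorem ArcsApart.curve_cut_ne {D : KnotDiagram} {u v u' v' : ℝ} (h : D.ArcsApart u v u' v')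
    (huv : u ≤ v) (n : ℕ) {q : ℝ} (hq : q ∈ Set.Icc u' v') :
    D.curve (cut u v n) ≠ D.curve q := fun e => by
  obtain ⟨⟨h₁, h₂, h₃⟩, -⟩ := h _ (cut_mem huv n) q hq e
  rcases cut_eq u v n with k | k | k
  exacts [h₁ k, h₂ k, h₃ n k]

theorem ArcsApart.endsApart {D : KnotDiagram} {u v u' v' : ℝ} (h : D.ArcsApart u v u' v')
    (huv : u ≤ v) (huv' : u' ≤ v') (i j : Fin (D.m + 1)) :
    EndsApart (D.curve (cut u v (i : ℕ))) (D.curve (cut u v ((i : ℕ) + 1)))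
      (D.curve (cut u' v' (j : ℕ))) (D.curve (cut u' v' ((j : ℕ) + 1))) := by
  constructor <;> intro t ht
  · obtain ⟨e, hm⟩ := exists_curve_eq huv' j ht
    rw [e]
    exact ⟨(h.curve_cut_ne huv i hm).symm,
      by exact_mod_cast (h.curve_cut_ne huv ((i : ℕ) + 1) hm).symm⟩
  · obtain ⟨e, hm⟩ := exists_curve_eq huv i ht
    rw [e]
    exact ⟨(h.symm.curve_cut_ne huv' j hm).symm,
      by exact_mod_cast (h.symm.curve_cut_ne huv' ((j : ℕ) + 1) hm).symm⟩

theorem sign_planeDet_smul {a b : ℝ} (ha : 0 < a) (hb : 0 < b) (x y : ℝ × ℝ) :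
    SignType.sign (planeDet (a • x) (b • y)) = SignType.sign (planeDet x y) := by
  have : planeDet (a • x) (b • y) = a * b * planeDet x y := by
    simp only [planeDet, Prod.smul_fst, Prod.smul_snd, smul_eq_mul]; ring
  rw [this, sign_mul, sign_pos (mul_pos ha hb), one_mul]

-- The segments are closed while `Meets` uses half-open edges; `ArcsApart` removes the difference,
-- since common points are neither vertices nor ends of the arcs. Collapsed edges contribute 0 on
-- both sides.
open Classical in
theorem ArcsApart.segmentIndex_eq {D : KnotDiagram} {u v u' v' : ℝ} (h : D.ArcsApart u v u' v')
    (huv : u ≤ v) (huv' : u' ≤ v') (i j : Fin (D.m + 1)) :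
    segmentIndex (D.curve (cut u v (i : ℕ))) (D.curve (cut u v ((i : ℕ) + 1)))
      (D.curve (cut u' v' (j : ℕ))) (D.curve (cut u' v' ((j : ℕ) + 1))) =
    if D.Meets i j ∧ D.position i j ∈ Set.Ioo u v ∧ D.position j i ∈ Set.Ioo u' v' then
      (SignType.sign (planeDet (D.dir i) (D.dir j)) : ℤ) else 0 := by
  rcases cut_cases huv (i : ℕ) with ⟨ha, ha'⟩ | ⟨ha₁, ha₂, ha₃, ha₄⟩
  · rw [if_neg fun ⟨k, k', _⟩ => ha' _ (lt_position k) (position_lt k) k']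
    simp [segmentIndex, ha, planeDet]
  rcases cut_cases huv' (j : ℕ) with ⟨hb, hb'⟩ | ⟨hb₁, hb₂, hb₃, hb₄⟩
  · rw [if_neg fun ⟨k, _, k'⟩ => hb' _ (lt_position (meets_symm k))
      (position_lt (meets_symm k)) k']
    simp [segmentIndex, hb, planeDet]
  have hx := fun t => exists_curve_eq (D := D) huv i (t := t)
  have hy := fun t => exists_curve_eq (D := D) huv' j (t := t)
  have ha₅ := curve_eq_point i ha₁ (by linarith)
  have ha₆ := curve_eq_point i (by linarith) ha₃
  have hb₅ := curve_eq_point j hb₁ (by linarith)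
  have hb₆ := curve_eq_point j (by linarith) hb₃
  generalize cut u v (i : ℕ) = a at *
  generalize cut u v ((i : ℕ) + 1) = a' at *
  generalize cut u' v' (j : ℕ) = b at *
  generalize cut u' v' ((j : ℕ) + 1) = b' at *
  have hda : D.curve a' - D.curve a = (a' - a) • D.dir i := by
    rw [ha₅, ha₆]; simp only [ClosedPolygon.point]; module
  have hdb : D.curve b' - D.curve b = (b' - b) • D.dir j := by
    rw [hb₅, hb₆]; simp only [ClosedPolygon.point]; module
  have ha₀ : 0 < a' - a := by linarith
  have hb₀ : 0 < b' - b := by linarith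
  rw [segmentIndex]
  rw [show planeDet (D.curve a' - D.curve a) (D.curve b' - D.curve b) =
    planeDet ((a' - a) • D.dir i) ((b' - b) • D.dir j) by rw [hda, hdb], sign_planeDet_smul ha₀ hb₀]
  by_cases hij : i = j
  · subst hij
    simp [planeDet, mul_comm]
  refine if_congr ⟨?_, ?_⟩ rfl rfl
  · rintro ⟨s, hs, t, ht, e⟩
    rw [(hx s hs).1, (hy t ht).1] at e
    obtain ⟨⟨h₁, h₂, h₃⟩, h₄, h₅, h₆⟩ := h _ (hx s hs).2 _ (hy t ht).2 e
    have hx' := (hx s hs).2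
    have hy' := (hy t ht).2
    have k₁ : 0 ≤ s * (a' - a) := mul_nonneg hs.1 (by linarith)
    have k₂ : s * (a' - a) ≤ a' - a := mul_le_of_le_one_left (by linarith) hs.2
    have k₃ : 0 ≤ t * (b' - b) := mul_nonneg ht.1 (by linarith)
    have k₄ : t * (b' - b) ≤ b' - b := mul_le_of_le_one_left (by linarith) ht.2
    -- The final vertex of the edge is excluded, so the parameters drop below 1 as `Meets` requires.
    have hi := h₃ ((i : ℕ) + 1)
    have hj := h₆ ((j : ℕ) + 1)
    push_cast at hi hj
    have l₁ : ((i : ℕ) : ℝ) ≤ a + s * (a' - a) := by linarith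
    have l₂ : a + s * (a' - a) ≤ (i : ℕ) + 1 := by linarith
    have l₃ : ((j : ℕ) : ℝ) ≤ b + t * (b' - b) := by linarith
    have l₄ : b + t * (b' - b) ≤ (j : ℕ) + 1 := by linarith
    generalize a + s * (a' - a) = p at *
    generalize b + t * (b' - b) = q at *
    have l₂' := lt_of_le_of_ne l₂ hi
    have l₄' := lt_of_le_of_ne l₄ hj
    rw [curve_eq_point i l₁ l₂, curve_eq_point j l₃ l₄] at e
    have hm : D.Meets i j :=
      ⟨hij, _, ⟨by linarith, by linarith⟩, _, ⟨by linarith, by linarith⟩, e⟩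
    rw [position, param_eq_of_point_eq hm e, position, param_eq_of_point_eq (meets_symm hm) e.symm,
      add_sub_cancel, add_sub_cancel]
    exact ⟨hm, ⟨lt_of_le_of_ne hx'.1 h₁.symm, lt_of_le_of_ne hx'.2 h₂⟩,
      lt_of_le_of_ne hy'.1 h₄.symm, lt_of_le_of_ne hy'.2 h₅⟩
  · rintro ⟨hm, hp, hq⟩
    obtain ⟨l₁, l₂⟩ := ha₄ _ (lt_position hm) (position_lt hm) hp.1 hp.2
    obtain ⟨l₃, l₄⟩ := hb₄ _ (lt_position (meets_symm hm)) (position_lt (meets_symm hm)) hq.1 hq.2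
    have hs : (D.position i j - a) / (a' - a) ∈ Set.Icc (0 : ℝ) 1 :=
      ⟨div_nonneg (by linarith) ha₀.le, (div_le_one ha₀).2 (by linarith)⟩
    have ht : (D.position j i - b) / (b' - b) ∈ Set.Icc (0 : ℝ) 1 :=
      ⟨div_nonneg (by linarith) hb₀.le, (div_le_one hb₀).2 (by linarith)⟩
    refine ⟨_, hs, _, ht, ?_⟩
    rw [(hx _ hs).1, (hy _ ht).1, div_mul_cancel₀ _ ha₀.ne', div_mul_cancel₀ _ hb₀.ne',
      add_sub_cancel, add_sub_cancel, curve_position hm]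

end KnotDiagram

/-! ### Intersection numbers of arcs and their vanishing for loops. -/

namespace KnotDiagram

open Classical in
/-- The sum of the signs of the intersections of two parts `α`, `β` of the curve. -/
noncomputable def intersectionNumber (D : KnotDiagram) (α β : Set ℝ) : ℤ :=
  ∑ i, ∑ j, if D.Meets i j ∧ D.position i j ∈ α ∧ D.position j i ∈ β then
    (SignType.sign (planeDet (D.dir i) (D.dir j)) : ℤ) else 0

/-- The sum of the indicator functions of the half-strips to the right of an arc. -/
noncomputable def stripSum (D : KnotDiagram) (u v : ℝ) (z : ℝ × ℝ) : ℤ :=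
  ∑ j : Fin (D.m + 1),
    stripIndex (D.curve (cut u v (j : ℕ))) (D.curve (cut u v ((j : ℕ) + 1))) z

/-- The intersection number of an arc and a horizontal ray. -/
noncomputable def raySum (D : KnotDiagram) (u v : ℝ) (z : ℝ × ℝ) : ℤ :=
  ∑ i : Fin (D.m + 1),
    rayIndex (D.curve (cut u v (i : ℕ))) (D.curve (cut u v ((i : ℕ) + 1))) z

/-- The sum telescopes between the clamped values of 0 and `N`, which are `u` and `v`. -/
theorem sum_cut (N : ℕ) {u v : ℝ} (hu : 0 ≤ u) (huv : u ≤ v) (hv : v ≤ N) (F : ℝ → ℤ) :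
    ∑ i : Fin N, (F (cut u v ((i : ℕ) + 1)) - F (cut u v (i : ℕ))) = F v - F u := by
  have h := Finset.sum_range_sub (fun n : ℕ => F (cut u v n)) N
  have h₀ : cut u v ((0 : ℕ) : ℝ) = u := by
    rw [cut, max_eq_left]
    exact (min_le_left _ _).trans (by simpa using hu)
  have h₁ : cut u v (N : ℝ) = v := by
    rw [cut, min_eq_right hv, max_eq_right huv]
  rw [h₀, h₁] at h
  rw [← h, ← Fin.sum_univ_eq_sum_range (fun n : ℕ => F (cut u v (n + 1 : ℕ)) - F (cut u v n)) N]
  push_cast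
  rfl

/-- Summing the boundary formula over pairs of edges, the strip terms telescope along the first arc
and the ray terms along the second. Only the end points survive, so nothing is left if both arcs are
loops. -/
theorem ArcsApart.intersectionNumber_eq {D : KnotDiagram} {u v u' v' : ℝ}
    (h : D.ArcsApart u v u' v') (hu : 0 ≤ u) (huv : u ≤ v) (hv : v ≤ (D.m + 1 : ℕ))
    (hu' : 0 ≤ u') (huv' : u' ≤ v') (hv' : v' ≤ (D.m + 1 : ℕ)) :
    D.intersectionNumber (Set.Ioo u v) (Set.Ioo u' v') =
      D.stripSum u' v' (D.curve v) - D.stripSum u' v' (D.curve u) +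
        (D.raySum u v (D.curve v') - D.raySum u v (D.curve u')) := by
  rw [← sum_cut _ hu huv hv (fun p => D.stripSum u' v' (D.curve p)),
    ← sum_cut _ hu' huv' hv' (fun p => D.raySum u v (D.curve p))]
  simp only [stripSum, raySum, ← Finset.sum_sub_distrib]
  rw [Finset.sum_comm (s := Finset.univ (α := Fin (D.m + 1)))
    (f := fun j i => rayIndex _ _ _ - rayIndex _ _ _)]
  simp only [← Finset.sum_add_distrib]
  refine Finset.sum_congr rfl fun i _ => Finset.sum_congr rfl fun j _ => ?_
  rw [← add_sub_assoc, ← segmentIndex_eq_boundary (h.endsApart huv huv' i j),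
    h.segmentIndex_eq huv huv' i j]
  congr

/-- Only the ends need checking: with disjoint parameter intervals any other common point is a
crossing, and crossings avoid vertices. -/
theorem arcsApart {D : KnotDiagram} {u v u' v' : ℝ} (hu₀ : 0 ≤ u) (hv₀ : v ≤ (D.m + 1 : ℕ))
    (hu₀' : 0 ≤ u') (hv₀' : v' ≤ (D.m + 1 : ℕ)) (hd : v < u' ∨ v' < u)
    (hu : ∀ q ∈ Set.Icc u' v', D.curve u ≠ D.curve q)
    (hv : ∀ q ∈ Set.Icc u' v', D.curve v ≠ D.curve q)
    (hu' : ∀ p ∈ Set.Icc u v, D.curve u' ≠ D.curve p)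
    (hv' : ∀ p ∈ Set.Icc u v, D.curve v' ≠ D.curve p) : D.ArcsApart u v u' v' := by
  intro p hp q hq e
  have h₁ : p ≠ u := by rintro rfl; exact hu q hq e
  have h₂ : p ≠ v := by rintro rfl; exact hv q hq e
  have h₃ : q ≠ u' := by rintro rfl; exact hu' p hp e.symm
  have h₄ : q ≠ v' := by rintro rfl; exact hv' p hp e.symm
  have l₁ := lt_of_le_of_ne hp.2 h₂
  have l₂ := lt_of_le_of_ne hq.2 h₄
  rcases eq_or_meets_of_curve_eq (hu₀.trans hp.1) (by linarith) (hu₀'.trans hq.1) (by linarith) e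
    with rfl | ⟨i, j, hm, k, k'⟩
  · rcases hd with hd | hd <;> linarith [hp.1, hp.2, hq.1, hq.2]
  · exact ⟨⟨h₁, h₂, fun n => by rw [k]; exact position_ne_natCast hm n⟩, h₃, h₄,
      fun n => by rw [k']; exact position_ne_natCast (meets_symm hm) n⟩

open Classical in
theorem intersectionNumber_swap (D : KnotDiagram) (α β : Set ℝ) :
    D.intersectionNumber β α = -D.intersectionNumber α β := by
  unfold intersectionNumber
  rw [Finset.sum_comm]
  simp only [← Finset.sum_neg_distrib]
  refine Finset.sum_congr rfl fun i _ => Finset.sum_congr rfl fun j _ => ?_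
  have h : planeDet (D.dir j) (D.dir i) = -planeDet (D.dir i) (D.dir j) := by
    simp only [planeDet]; ring
  have e : (D.Meets j i ∧ D.position j i ∈ β ∧ D.position i j ∈ α) ↔
      (D.Meets i j ∧ D.position i j ∈ α ∧ D.position j i ∈ β) :=
    ⟨fun k => ⟨meets_symm k.1, k.2.2, k.2.1⟩, fun k => ⟨meets_symm k.1, k.2.2, k.2.1⟩⟩
  by_cases k : D.Meets i j ∧ D.position i j ∈ α ∧ D.position j i ∈ β
  · rw [if_pos k, if_pos (e.2 k), h, Left.sign_neg]
    simp
  · rw [if_neg k, if_neg (mt e.1 k), neg_zero]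

theorem intersectionNumber_union (D : KnotDiagram) {α α' : Set ℝ} (h : Disjoint α α')
    (β : Set ℝ) : D.intersectionNumber (α ∪ α') β =
      D.intersectionNumber α β + D.intersectionNumber α' β := by
  unfold intersectionNumber
  simp only [← Finset.sum_add_distrib]
  refine Finset.sum_congr rfl fun i _ => Finset.sum_congr rfl fun j _ => ?_
  have h' : ¬ (D.position i j ∈ α ∧ D.position i j ∈ α') :=
    fun k => Set.disjoint_left.1 h k.1 k.2
  rw [Set.mem_union]
  split_ifs <;> first | (exfalso; tauto) | simp

open Classical in
theorem intersectionNumber_congr (D : KnotDiagram) {α α' β : Set ℝ}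
    (h : ∀ p : ℝ, 0 < p → p < (D.m + 1 : ℕ) → (p ∈ α ↔ p ∈ α')) :
    D.intersectionNumber α β = D.intersectionNumber α' β := by
  unfold intersectionNumber
  refine Finset.sum_congr rfl fun i _ => Finset.sum_congr rfl fun j _ => if_congr ?_ rfl rfl
  exact and_congr_right fun hm => by
    rw [h _ (position_pos hm) (position_lt_length hm)]

/-- `p` and `p'` are the two positions of a crossing. -/
def IsDouble (D : KnotDiagram) (p p' : ℝ) : Prop :=
  ∃ i j, D.Meets i j ∧ p = D.position i j ∧ p' = D.position j i

theorem IsDouble.symm {D : KnotDiagram} {p p' : ℝ} (h : D.IsDouble p p') : D.IsDouble p' p := by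
  obtain ⟨i, j, hm, h, h'⟩ := h
  exact ⟨j, i, meets_symm hm, h', h⟩

theorem IsDouble.pos {D : KnotDiagram} {p p' : ℝ} (h : D.IsDouble p p') : 0 < p := by
  obtain ⟨i, j, hm, rfl, -⟩ := h
  exact position_pos hm

theorem IsDouble.lt_length {D : KnotDiagram} {p p' : ℝ} (h : D.IsDouble p p') :
    p < (D.m + 1 : ℕ) := by
  obtain ⟨i, j, hm, rfl, -⟩ := h
  exact position_lt_length hm

theorem IsDouble.curve_eq {D : KnotDiagram} {p p' : ℝ} (h : D.IsDouble p p') :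
    D.curve p = D.curve p' := by
  obtain ⟨i, j, hm, rfl, rfl⟩ := h
  exact curve_position hm

/-- With no triple points, a crossing is visited at its two positions only. -/
theorem IsDouble.curve_ne {D : KnotDiagram} {p p' u v : ℝ} (h : D.IsDouble p p') (hu : 0 ≤ u)
    (hv : v ≤ (D.m + 1 : ℕ)) (k : p ∉ Set.Icc u v) (k' : p' ∉ Set.Icc u v) :
    ∀ q ∈ Set.Icc u v, D.curve p ≠ D.curve q := by
  obtain ⟨i, j, hm, rfl, rfl⟩ := h
  rintro q hq e
  rcases eq_position_of_curve_eq hm (hu.trans hq.1) (hq.2.trans hv) e with rfl | rfl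
  exacts [k hq, k' hq]

theorem curve_zero_ne {D : KnotDiagram} {u v : ℝ} (hu : 0 < u) (hv : v < (D.m + 1 : ℕ)) :
    ∀ q ∈ Set.Icc u v, D.curve 0 ≠ D.curve q := by
  rintro q hq e
  rcases eq_zero_or_length_of_curve_eq (hu.le.trans hq.1) (hq.2.trans hv.le) e with rfl | rfl
  · exact absurd hq.1 (by linarith)
  · exact absurd hq.2 (by linarith)

theorem intersectionNumber_Ioo_Ioo {D : KnotDiagram} {p p' q q' : ℝ} (hp : D.IsDouble p p')
    (hq : D.IsDouble q q') (hpp : p < p') (hqq : q < q') (hd : p' < q ∨ q' < p) :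
    D.intersectionNumber (Set.Ioo p p') (Set.Ioo q q') = 0 := by
  have k₁ : p ∉ Set.Icc q q' := fun k => by rcases hd with h | h <;> linarith [k.1, k.2]
  have k₂ : p' ∉ Set.Icc q q' := fun k => by rcases hd with h | h <;> linarith [k.1, k.2]
  have k₃ : q ∉ Set.Icc p p' := fun k => by rcases hd with h | h <;> linarith [k.1, k.2]
  have k₄ : q' ∉ Set.Icc p p' := fun k => by rcases hd with h | h <;> linarith [k.1, k.2]
  have h : D.ArcsApart p p' q q' :=
    arcsApart hp.pos.le hp.symm.lt_length.le hq.pos.le hq.symm.lt_length.le hd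
      (hp.curve_ne hq.pos.le hq.symm.lt_length.le k₁ k₂)
      (hp.symm.curve_ne hq.pos.le hq.symm.lt_length.le k₂ k₁)
      (hq.curve_ne hp.pos.le hp.symm.lt_length.le k₃ k₄)
      (hq.symm.curve_ne hp.pos.le hp.symm.lt_length.le k₄ k₃)
  rw [h.intersectionNumber_eq hp.pos.le hpp.le hp.symm.lt_length.le hq.pos.le hqq.le
    hq.symm.lt_length.le, hp.curve_eq, hq.curve_eq]
  ring

/-- The loop through the base point is cut there into two arcs. Neither is closed, but their
boundary terms at the base point cancel, as do those at the crossing; the base point itself is no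
crossing and can be dropped. -/
theorem intersectionNumber_compl_Ioo {D : KnotDiagram} {p p' q q' : ℝ} (hp : D.IsDouble p p')
    (hq : D.IsDouble q q') (h₁ : p' < q) (h₂ : q < q') (h₃ : q' < p) :
    D.intersectionNumber {x | p < x ∨ x < p'} (Set.Ioo q q') = 0 := by
  have hN := hp.lt_length
  have hq₀ := hq.pos
  have hp₀ := hp.symm.pos
  have k₁ : p ∉ Set.Icc q q' := fun k => by linarith [k.1, k.2]
  have k₂ : p' ∉ Set.Icc q q' := fun k => by linarith [k.1, k.2]
  have hz := D.curve_length
  have a₁ : D.ArcsApart p (D.m + 1 : ℕ) q q' :=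
    arcsApart hp.pos.le le_rfl hq.pos.le hq.symm.lt_length.le (Or.inr h₃)
      (hp.curve_ne hq.pos.le hq.symm.lt_length.le k₁ k₂)
      (by rw [hz]; exact curve_zero_ne hq.pos hq.symm.lt_length)
      (hq.curve_ne hp.pos.le le_rfl (fun k => by linarith [k.1]) (fun k => by linarith [k.1]))
      (hq.symm.curve_ne hp.pos.le le_rfl (fun k => by linarith [k.1])
        (fun k => by linarith [k.1]))
  have a₂ : D.ArcsApart 0 p' q q' :=
    arcsApart le_rfl hp.symm.lt_length.le hq.pos.le hq.symm.lt_length.le (Or.inl h₁)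
      (curve_zero_ne hq.pos hq.symm.lt_length)
      (hp.symm.curve_ne hq.pos.le hq.symm.lt_length.le k₂ k₁)
      (hq.curve_ne le_rfl hp.symm.lt_length.le (fun k => by linarith [k.2])
        (fun k => by linarith [k.2]))
      (hq.symm.curve_ne le_rfl hp.symm.lt_length.le (fun k => by linarith [k.2])
        (fun k => by linarith [k.2]))
  rw [D.intersectionNumber_congr (α' := Set.Ioo p (D.m + 1 : ℕ) ∪ Set.Ioo 0 p')
      (fun x hx hx' => by simp only [Set.mem_union, Set.mem_ofPred_eq, Set.mem_Ioo, hx, hx',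
        and_true, true_and]),
    intersectionNumber_union, a₁.intersectionNumber_eq hp.pos.le hN.le le_rfl hq.pos.le h₂.le
      hq.symm.lt_length.le, a₂.intersectionNumber_eq le_rfl hp₀.le hp.symm.lt_length.le hq.pos.le
      h₂.le hq.symm.lt_length.le, hp.curve_eq, hq.curve_eq, hz]
  · ring
  · rw [Set.disjoint_left]
    rintro x hx hx'
    linarith [hx.1, hx'.2]

/-- Two closed curves in the plane have the intersection number `0`: here, two disjoint arcs of a
knot diagram that return to their first points. -/
theorem intersectionNumber_cyclic {D : KnotDiagram} {p p' q q' : ℝ} (hp : D.IsDouble p p')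
    (hq : D.IsDouble q q') (h : CyclicLT p p' q) (h' : CyclicLT p q q') :
    D.intersectionNumber {x | CyclicLT p x p'} {x | CyclicLT q x q'} = 0 := by
  have lin : ∀ {a b : ℝ}, a < b → {x | CyclicLT a x b} = Set.Ioo a b := fun hab => by
    ext x; simp only [CyclicLT, Set.mem_ofPred_eq, Set.mem_Ioo]; grind
  have wrap : ∀ {a b : ℝ}, b < a → {x | CyclicLT a x b} = {x | a < x ∨ x < b} := fun hab => by
    ext x; simp only [CyclicLT, Set.mem_ofPred_eq]; grind
  simp only [CyclicLT] at h h'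
  -- The four places of the base point: on neither loop in the first and third cases, on the first
  -- loop in the second case, on the second loop in the fourth.
  have : (p < p' ∧ p' < q ∧ q < q') ∨ (p' < q ∧ q < q' ∧ q' < p) ∨ (q < q' ∧ q' < p ∧ p < p') ∨
      (q' < p ∧ p < p' ∧ p' < q) := by grind
  rcases this with ⟨h₁, h₂, h₃⟩ | ⟨h₁, h₂, h₃⟩ | ⟨h₁, h₂, h₃⟩ | ⟨h₁, h₂, h₃⟩
  · rw [lin h₁, lin h₃]
    exact intersectionNumber_Ioo_Ioo hp hq h₁ h₃ (Or.inl h₂)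
  · rw [lin h₂, wrap (by linarith)]
    exact intersectionNumber_compl_Ioo hp hq h₁ h₂ h₃
  · rw [lin h₁, lin h₃]
    exact intersectionNumber_Ioo_Ioo hp hq h₃ h₁ (Or.inr h₂)
  · rw [lin h₂, wrap (by linarith), intersectionNumber_swap,
      intersectionNumber_compl_Ioo hq hp h₁ h₂ h₃, neg_zero]

-- The sign of a crossing is that of det(upper, lower). If the lower strand (foot) is on `α`, the
-- local intersection number of `α` with `β` is minus that sign; if the upper one is, it is plus.
open Classical in
theorem sum_crossing_eq_intersectionNumber (D : KnotDiagram) [Fintype D.Crossing] (α β : Set ℝ) :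
    ∑ c : D.Crossing, (D.gaussDiagram.sign c : ℤ) *
      ((if D.gaussDiagram.foot c ∈ α ∧ D.gaussDiagram.head c ∈ β then 1 else 0) -
        (if D.gaussDiagram.head c ∈ α ∧ D.gaussDiagram.foot c ∈ β then 1 else 0)) =
      -D.intersectionNumber α β := by
  set F : Fin (D.m + 1) → Fin (D.m + 1) → ℤ := fun i j =>
    if D.Meets i j ∧ D.position i j ∈ α ∧ D.position j i ∈ β then
      (SignType.sign (planeDet (D.dir i) (D.dir j)) : ℤ) else 0 with hF
  have h₁ : ∀ c : D.Crossing, (D.gaussDiagram.sign c : ℤ) *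
      ((if D.gaussDiagram.foot c ∈ α ∧ D.gaussDiagram.head c ∈ β then 1 else 0) -
        (if D.gaussDiagram.head c ∈ α ∧ D.gaussDiagram.foot c ∈ β then 1 else 0)) =
      -(F c.1.1 c.1.2 + F c.1.2 c.1.1) := by
    rintro ⟨⟨i, j⟩, hm, ho⟩
    have h : planeDet (D.dir j) (D.dir i) = -planeDet (D.dir i) (D.dir j) := by
      simp only [planeDet]; ring
    have hs : (D.gaussDiagram.sign ⟨⟨i, j⟩, hm, ho⟩ : ℤ) =
        SignType.sign (planeDet (D.dir i) (D.dir j)) := by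
      simp only [gaussDiagram]
      split_ifs with hp
      · simp [sign_pos hp]
      · rw [sign_neg (lt_of_le_of_ne (not_lt.1 hp) (D.transverse i j hm))]
        simp
    rw [hs]
    simp only [hF, gaussDiagram, h, Left.sign_neg, hm, meets_symm hm, true_and]
    simp only [and_comm (a := D.position i j ∈ α), and_comm (a := D.position j i ∈ α)]
    split_ifs <;> simp
  -- Crossings list each pair of meeting edges once, upper edge first; adding the sum with the edges
  -- exchanged recovers all ordered pairs.
  have h₂ : ∀ G : Fin (D.m + 1) → Fin (D.m + 1) → ℤ, ∑ c : D.Crossing, G c.1.1 c.1.2 =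
      ∑ i, ∑ j, if D.Meets i j ∧ D.isOver i j then G i j else 0 := fun G => by
    rw [← Fintype.sum_prod_type' (f := fun i j => if D.Meets i j ∧ D.isOver i j then G i j else 0),
      ← Finset.sum_filter]
    exact (Finset.sum_subtype _ (by simp) fun x : Fin (D.m + 1) × Fin (D.m + 1) => G x.1 x.2).symm
  rw [Finset.sum_congr rfl fun c _ => h₁ c, Finset.sum_neg_distrib, Finset.sum_add_distrib, h₂ F,
    h₂ fun i j => F j i, Finset.sum_comm (f := fun i j => ite _ (F j i) _),
    intersectionNumber]
  simp only [← Finset.sum_add_distrib]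
  congr 1
  refine Finset.sum_congr rfl fun i _ => Finset.sum_congr rfl fun j _ => ?_
  by_cases hm : D.Meets i j
  · have := D.isOver_iff i j hm
    have := meets_symm hm
    by_cases ho : D.isOver i j
    · rw [if_pos ⟨hm, ho⟩, if_neg (by tauto), add_zero]
    · rw [if_neg (by tauto), if_pos (by tauto), zero_add]
  · rw [if_neg (by tauto), if_neg (fun k => hm (meets_symm k.1)), if_neg (by tauto)]
    rfl

end KnotDiagram

/-! ### Cyclic order. -/

/-- The foot of the arrow `a` if `d = true`, and its head if `d = false`. -/
def arrowEnd {ι : Type*} (d : Bool) (a : ι) : ι ⊕ ι := if d then Sum.inl a else Sum.inr a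

theorem map_arrowEnd {ι κ : Type*} (f : ι → κ) (d : Bool) (a : ι) :
    Sum.map f f (arrowEnd d a) = arrowEnd d (f a) := by
  cases d <;> rfl

namespace CyclicLT

variable {P : Type*} [LinearOrder P] {a b c d : P}

theorem rotate (h : CyclicLT a b c) : CyclicLT b c a := by
  simp only [CyclicLT] at *; tauto

theorem ne_left (h : CyclicLT a b c) : a ≠ b := by
  rintro rfl
  rcases h with ⟨h, -⟩ | ⟨h, h'⟩ | ⟨-, h⟩
  exacts [h.false, (h.trans h').false, h.false]

theorem trans_left (h : CyclicLT a b c) (h' : CyclicLT a c d) : CyclicLT a b d := by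
  simp only [CyclicLT] at *; grind

theorem trans_right (h : CyclicLT a b c) (h' : CyclicLT a c d) : CyclicLT b c d := by
  simp only [CyclicLT] at *; grind

end CyclicLT

theorem CyclicLT.total {P : Type*} [LinearOrder P] {a b c : P} (h₁ : a ≠ b) (h₂ : b ≠ c)
    (h₃ : a ≠ c) : CyclicLT a b c ∨ CyclicLT b a c := by
  simp only [CyclicLT]; grind

/-- A finite sequence is in cyclic order if all its consecutive points are in cyclic order with the
first one. -/
theorem forall_cyclicLT_iff {P : Type*} [LinearOrder P] {n : ℕ} (g : Fin (n + 1) → P) :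
    (∀ i j k, CyclicLT i j k → CyclicLT (g i) (g j) (g k)) ↔
      ∀ i j : Fin (n + 1), 0 < i.val → i.val + 1 = j.val → CyclicLT (g 0) (g i) (g j) := by
  constructor
  · intro h i j hi hj
    exact h _ _ _ (Or.inl ⟨hi, Fin.lt_def.2 (by omega)⟩)
  · intro h
    have h₁ : ∀ i : Fin (n + 1), 0 < i.val → ∀ j : ℕ, i.val + 1 ≤ j → ∀ hj : j < n + 1,
        CyclicLT (g 0) (g i) (g ⟨j, hj⟩) := by
      intro i hi j hij
      induction j, hij using Nat.le_induction with
      | base => exact fun hj => h i _ hi rfl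
      | succ j hij ih =>
        exact fun hj => (ih (by omega)).trans_left (h ⟨j, by omega⟩ _ (by simp; omega) rfl)
    have h₂ : ∀ i j k : Fin (n + 1), i < j → j < k → CyclicLT (g i) (g j) (g k) := by
      intro i j k hij hjk
      have hj : 0 < j.val := by have := Fin.lt_def.1 hij; omega
      rcases Nat.eq_zero_or_pos i.val with hi | hi
      · obtain rfl : i = 0 := Fin.ext hi
        exact h₁ j hj k hjk k.2
      · exact (h₁ i hi j hij j.2).trans_right (h₁ j hj k hjk k.2)
    rintro i j k (⟨h, h'⟩ | ⟨h, h'⟩ | ⟨h, h'⟩)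
    · exact h₂ _ _ _ h h'
    · exact (h₂ _ _ _ h h').rotate.rotate
    · exact (h₂ _ _ _ h h').rotate

/-! ### Homomorphisms as chains of order conditions. -/

namespace ArrowDiagram

variable {κ ι P : Type*} [LinearOrder P]

/-- Homomorphisms in terms of an enumeration `σ` of the endpoints along the circle. -/
theorem isHom_iff {n : ℕ} {A : ArrowDiagram κ (Fin (n + 3))} {σ : Fin (n + 3) → κ ⊕ κ}
    (hσ : Function.Surjective σ) (hA : ∀ i, A.pos (σ i) = i) (G : ArrowDiagram ι P) (f : κ → ι) :
    A.IsHom G f ↔ ∀ i j : Fin (n + 3), 0 < i.val → i.val + 1 = j.val →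
      CyclicLT (G.pos (Sum.map f f (σ 0))) (G.pos (Sum.map f f (σ i)))
        (G.pos (Sum.map f f (σ j))) := by
  rw [← forall_cyclicLT_iff (fun i => G.pos (Sum.map f f (σ i)))]
  constructor
  · intro h i j k hijk
    exact h.2 _ _ _ (by rwa [hA, hA, hA])
  · intro h
    refine ⟨fun a b hab => ?_, fun x y z hxyz => ?_⟩
    · obtain ⟨i, hi⟩ := hσ (Sum.inl a)
      obtain ⟨j, hj⟩ := hσ (Sum.inl b)
      have e : G.pos (Sum.map f f (σ i)) = G.pos (Sum.map f f (σ j)) := by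
        rw [hi, hj, Sum.map_inl, Sum.map_inl, hab]
      by_cases hij : i = j
      · subst hij
        exact Sum.inl_injective (hi.symm.trans hj)
      -- `CyclicLT` separates points only within a triple, so injectivity needs a third endpoint;
      -- this is the reason for `n + 3`.
      · obtain ⟨k, hk⟩ : ∃ k, k ∉ ({i, j} : Finset (Fin (n + 3))) := by
          by_contra! hk
          have h₁ := Finset.card_le_card (fun k _ => hk k : Finset.univ ⊆ {i, j})
          have h₂ := Finset.card_le_two (a := i) (b := j)
          rw [Finset.card_univ, Fintype.card_fin] at h₁
          omega
        simp only [Finset.mem_insert, Finset.mem_singleton, not_or] at hk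
        rcases CyclicLT.total hij (Ne.symm hk.2) (Ne.symm hk.1) with hc | hc
        · exact absurd e (h _ _ _ hc).ne_left
        · exact absurd e.symm (h _ _ _ hc).ne_left
    · obtain ⟨i, rfl⟩ := hσ x
      obtain ⟨j, rfl⟩ := hσ y
      obtain ⟨k, rfl⟩ := hσ z
      rw [hA, hA, hA] at hxyz
      exact h _ _ _ hxyz

theorem pos_rebase {n : ℕ} (k : Fin (n + 1)) (A : ArrowDiagram κ (Fin (n + 1))) (x : κ ⊕ κ) :
    (A.rebase k).pos x = A.pos x - k := by
  cases x <;> rfl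

/-- From the shifted base point the endpoints are read as `σ k`, `σ (k + 1)`, and so on around the
circle. Strict monotonicity is checked on neighbours and already forces injectivity. -/
theorem isBasedHom_rebase_iff {n : ℕ} {A : ArrowDiagram κ (Fin (n + 1))}
    {σ : Fin (n + 1) → κ ⊕ κ} (hσ : Function.Surjective σ) (hA : ∀ i, A.pos (σ i) = i)
    (k : Fin (n + 1)) (G : ArrowDiagram ι P) (f : κ → ι) :
    (A.rebase k).IsBasedHom G f ↔ ∀ i : Fin n,
      G.pos (Sum.map f f (σ (i.castSucc + k))) < G.pos (Sum.map f f (σ (i.succ + k))) := by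
  rw [← Fin.strictMono_iff_lt_succ (f := fun i => G.pos (Sum.map f f (σ (i + k))))]
  constructor
  · intro h i j hij
    exact h.2 _ _ (by rwa [pos_rebase, pos_rebase, hA, hA, add_sub_cancel_right,
      add_sub_cancel_right])
  · intro h
    refine ⟨fun a b hab => ?_, fun x y hxy => ?_⟩
    · obtain ⟨i, hi⟩ := hσ (Sum.inl a)
      obtain ⟨j, hj⟩ := hσ (Sum.inl b)
      have := @StrictMono.injective _ _ _ _ _ h (i - k) (j - k)
        (by simp only [sub_add_cancel]; rw [hi, hj, Sum.map_inl, Sum.map_inl, hab])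
      obtain rfl := sub_left_injective this
      exact Sum.inl_injective (hi.symm.trans hj)
    · obtain ⟨i, rfl⟩ := hσ x
      obtain ⟨j, rfl⟩ := hσ y
      rw [pos_rebase, pos_rebase, hA, hA] at hxy
      simpa using h hxy

/-- The endpoints of a `verticalPair` along the circle. -/
def verticalPairEnd (right left horizontal : Bool) : Fin 6 → Fin 3 ⊕ Fin 3 :=
  ![arrowEnd right 0, arrowEnd horizontal 2, arrowEnd (!right) 0, arrowEnd left 1,
    arrowEnd (!horizontal) 2, arrowEnd (!left) 1]

theorem surjective_verticalPairEnd : ∀ right left horizontal : Bool,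
    Function.Surjective (verticalPairEnd right left horizontal) := by
  unfold Function.Surjective; decide

theorem pos_verticalPairEnd : ∀ (right left horizontal : Bool) (i : Fin 6),
    (verticalPair right left horizontal).pos (verticalPairEnd right left horizontal i) = i := by
  decide

/-- The endpoints of a `trianglePlus` along the circle. -/
def trianglePlusEnd (side₀ side₁ side₂ fourth : Bool) : Fin 8 → Fin 4 ⊕ Fin 4 :=
  ![arrowEnd side₀ 0, arrowEnd fourth 3, arrowEnd (!side₀) 0, arrowEnd side₁ 1,
    arrowEnd (!fourth) 3, arrowEnd (!side₁) 1, arrowEnd side₂ 2, arrowEnd (!side₂) 2]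

theorem surjective_trianglePlusEnd : ∀ side₀ side₁ side₂ fourth : Bool,
    Function.Surjective (trianglePlusEnd side₀ side₁ side₂ fourth) := by
  unfold Function.Surjective; decide

theorem pos_trianglePlusEnd : ∀ (side₀ side₁ side₂ fourth : Bool) (i : Fin 8),
    (trianglePlus side₀ side₁ side₂ fourth).pos (trianglePlusEnd side₀ side₁ side₂ fourth i) =
      i := by
  decide

end ArrowDiagram

/-! ### Exchanging the direction of one arrow in a Gauss diagram. -/

namespace SignedArrowDiagram

variable {ι P : Type*} [Fintype ι] [LinearOrder P]

/-- The arrows `a`, `b` are met in the order `a, a, b, b` along the circle; `d` and `e` tell which of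
their endpoints is met first. -/
def IsDisjointPair (G : SignedArrowDiagram ι P) (d e : Bool) (a b : ι) : Prop :=
  CyclicLT (G.pos (arrowEnd d a)) (G.pos (arrowEnd (!d) a)) (G.pos (arrowEnd e b)) ∧
    CyclicLT (G.pos (arrowEnd d a)) (G.pos (arrowEnd e b)) (G.pos (arrowEnd (!e) b))

/-- The arrow `h` joins the arcs cut off by the arrows `a` and `b`; if `t = true`, it starts at the
arc cut off by `a`. -/
def Joins (G : SignedArrowDiagram ι P) (d e : Bool) (a b : ι) (t : Bool) (h : ι) : Prop :=
  CyclicLT (G.pos (arrowEnd d a)) (G.pos (arrowEnd t h)) (G.pos (arrowEnd (!d) a)) ∧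
    CyclicLT (G.pos (arrowEnd e b)) (G.pos (arrowEnd (!t) h)) (G.pos (arrowEnd (!e) b))

-- The arcs cut off by `a` and `b` are loops of the knot diagram with intersection number 0; the
-- arrows joining them are the crossings of the two loops, counted by direction.
open Classical in
theorem IsGaussDiagram.sum_joins {G : SignedArrowDiagram ι P} (hG : G.IsGaussDiagram)
    {d e : Bool} {a b : ι} (hab : G.IsDisjointPair d e a b) :
    ∑ h, (if G.Joins d e a b true h then (G.sign h : ℤ) else 0) =
      ∑ h, (if G.Joins d e a b false h then (G.sign h : ℤ) else 0) := by
  obtain ⟨D, ε, hpos, hsign⟩ := hG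
  let _ : Fintype D.Crossing := Fintype.ofEquiv ι ε
  have hc : ∀ x y z, CyclicLT (G.pos x) (G.pos y) (G.pos z) ↔
      CyclicLT (D.gaussDiagram.pos (Sum.map ε ε x)) (D.gaussDiagram.pos (Sum.map ε ε y))
        (D.gaussDiagram.pos (Sum.map ε ε z)) := fun x y z => by
    simp only [CyclicLT, hpos]
  have hdouble : ∀ (d : Bool) (c : D.Crossing), D.IsDouble (D.gaussDiagram.pos (arrowEnd d c))
      (D.gaussDiagram.pos (arrowEnd (!d) c)) := by
    rintro d ⟨⟨i, j⟩, hm, ho⟩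
    cases d
    · exact ⟨i, j, hm, rfl, rfl⟩
    · exact ⟨j, i, KnotDiagram.meets_symm hm, rfl, rfl⟩
  simp only [IsDisjointPair, hc, map_arrowEnd] at hab
  have key := D.sum_crossing_eq_intersectionNumber
    {x | CyclicLT (D.gaussDiagram.pos (arrowEnd d (ε a))) x
      (D.gaussDiagram.pos (arrowEnd (!d) (ε a)))}
    {x | CyclicLT (D.gaussDiagram.pos (arrowEnd e (ε b))) x
      (D.gaussDiagram.pos (arrowEnd (!e) (ε b)))}
  rw [KnotDiagram.intersectionNumber_cyclic (hdouble _ _) (hdouble _ _) hab.1 hab.2, neg_zero,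
    ← Equiv.sum_comp ε] at key
  rw [← sub_eq_zero, ← Finset.sum_sub_distrib]
  refine Eq.trans ?_ key
  refine Finset.sum_congr rfl fun h _ => ?_
  simp only [Joins, hc, map_arrowEnd, hsign, Set.mem_ofPred_eq, mul_sub, mul_ite, mul_one, mul_zero]
  rfl

open Classical in
/-- Two sums over sequences of arrows of a Gauss diagram are equal if they differ only in the
direction of an arrow, the last one, that joins the arcs cut off by two disjoint arrows. -/
theorem IsGaussDiagram.sum_filter_eq {G : SignedArrowDiagram ι P} (hG : G.IsGaussDiagram) {n : ℕ}
    {p q : (Fin (n + 1) → ι) → Prop} (C : (Fin n → ι) → Prop) (d e : Bool) (i j : Fin n)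
    (hC : ∀ f, C f → G.IsDisjointPair d e (f i) (f j))
    (hp : ∀ f, p f ↔ C (fun k => f k.castSucc) ∧
      G.Joins d e (f i.castSucc) (f j.castSucc) true (f (Fin.last n)))
    (hq : ∀ f, q f ↔ C (fun k => f k.castSucc) ∧
      G.Joins d e (f i.castSucc) (f j.castSucc) false (f (Fin.last n))) :
    ∑ f ∈ Finset.univ.filter p, ∏ a, (G.sign (f a) : ℤ) =
      ∑ f ∈ Finset.univ.filter q, ∏ a, (G.sign (f a) : ℤ) := by
  have key : ∀ (t : Bool) (r : (Fin (n + 1) → ι) → Prop),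
      (∀ f, r f ↔ C (fun k => f k.castSucc) ∧
        G.Joins d e (f i.castSucc) (f j.castSucc) t (f (Fin.last n))) →
      ∑ f ∈ Finset.univ.filter r, ∏ a, (G.sign (f a) : ℤ) =
        ∑ f : Fin n → ι, if C f then (∏ a, (G.sign (f a) : ℤ)) *
          ∑ h, (if G.Joins d e (f i) (f j) t h then (G.sign h : ℤ) else 0) else 0 := by
    intro t r hr
    -- The last arrow is split off and summed first; its sign factors out of the product, and `C`
    -- does not involve it.
    rw [Finset.sum_filter, ← Equiv.sum_comp (Fin.snocEquiv fun _ => ι), Fintype.sum_prod_type_right]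
    refine Finset.sum_congr rfl fun f _ => ?_
    have hs : ∀ h, r (Fin.snocEquiv (fun _ => ι) (h, f)) ↔ C f ∧ G.Joins d e (f i) (f j) t h :=
      fun h => by rw [hr]; simp [Fin.snocEquiv]
    have hprod : ∀ h, ∏ a, (G.sign (Fin.snocEquiv (fun _ => ι) (h, f) a) : ℤ) =
        (∏ a, (G.sign (f a) : ℤ)) * G.sign h := fun h => by
      rw [Fin.prod_univ_castSucc]; simp [Fin.snocEquiv]
    simp only [hs, hprod]
    by_cases h : C f
    · simp only [h, true_and, if_true, Finset.mul_sum, mul_ite, mul_zero]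
    · simp [h]
  rw [key true p hp, key false q hq]
  refine Finset.sum_congr rfl fun f _ => ?_
  split_ifs with h
  · rw [hG.sum_joins (hC f h)]
  · rfl

end SignedArrowDiagram

/-! ### Separating the crossing arrow from the other arrows. -/

namespace CyclicLT

variable {P : Type*} [LinearOrder P]

/-- The points `x₀`, `x₂`, `x₃`, `x₅` are the ends of two disjoint arrows. Once they are placed, the
ends `x₁` and `x₄` of the arrow crossing both range independently over the two arcs cut off. -/
theorem chain₆_iff {x₀ x₁ x₂ x₃ x₄ x₅ : P} :
    (CyclicLT x₀ x₁ x₂ ∧ CyclicLT x₀ x₂ x₃ ∧ CyclicLT x₀ x₃ x₄ ∧ CyclicLT x₀ x₄ x₅) ↔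
      (CyclicLT x₀ x₂ x₃ ∧ CyclicLT x₀ x₃ x₅) ∧ CyclicLT x₀ x₁ x₂ ∧ CyclicLT x₃ x₄ x₅ := by
  constructor
  · rintro ⟨h₁, h₂, h₃, h₄⟩
    exact ⟨⟨h₂, h₃.trans_left h₄⟩, h₁, h₃.trans_right h₄⟩
  · rintro ⟨⟨h₁, h₂⟩, h₃, h₄⟩
    exact ⟨h₃, h₁, (h₄.trans_left h₂.rotate).rotate.rotate,
      (h₄.trans_right h₂.rotate).rotate.rotate⟩

end CyclicLT

namespace SignedArrowDiagram

variable {ι P : Type*} [LinearOrder P]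

/-- The arrows `a`, `b` are met in the order `a, a, b, b` from the base point. -/
def IsBasedPair (G : SignedArrowDiagram ι P) (d e : Bool) (a b : ι) : Prop :=
  G.pos (arrowEnd d a) < G.pos (arrowEnd (!d) a) ∧ G.pos (arrowEnd (!d) a) < G.pos (arrowEnd e b) ∧
    G.pos (arrowEnd e b) < G.pos (arrowEnd (!e) b)

theorem IsBasedPair.isDisjointPair {G : SignedArrowDiagram ι P} {d e : Bool} {a b : ι}
    (h : G.IsBasedPair d e a b) : G.IsDisjointPair d e a b :=
  ⟨Or.inl ⟨h.1, h.2.1⟩, Or.inl ⟨h.1.trans h.2.1, h.2.2⟩⟩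

theorem IsBasedPair.isDisjointPair_swap {G : SignedArrowDiagram ι P} {d e : Bool} {a b : ι}
    (h : G.IsBasedPair d e a b) : G.IsDisjointPair e d b a :=
  ⟨Or.inr (Or.inr ⟨h.1.trans h.2.1, h.2.2⟩), Or.inr (Or.inl ⟨h.1, h.2.1⟩)⟩

end SignedArrowDiagram

namespace ArrowDiagram

variable {ι P : Type*} [LinearOrder P]

theorem isHom_verticalPair_iff (G : SignedArrowDiagram ι P) (r l t : Bool) (f : Fin 3 → ι) :
    (verticalPair r l t).IsHom G.toArrowDiagram f ↔
      G.IsDisjointPair r l (f 0) (f 1) ∧ G.Joins r l (f 0) (f 1) t (f 2) := by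
  rw [isHom_iff (surjective_verticalPairEnd r l t) (pos_verticalPairEnd r l t)]
  simp [Fin.forall_fin_succ, verticalPairEnd, map_arrowEnd]
  rw [CyclicLT.chain₆_iff]
  rfl

theorem isBasedHom_verticalPair_iff (G : SignedArrowDiagram ι P) (r l t : Bool) (f : Fin 3 → ι) :
    ((verticalPair r l t).rebase 0).IsBasedHom G.toArrowDiagram f ↔
      G.IsBasedPair r l (f 0) (f 1) ∧ G.Joins r l (f 0) (f 1) t (f 2) := by
  rw [isBasedHom_rebase_iff (surjective_verticalPairEnd r l t) (pos_verticalPairEnd r l t)]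
  simp [Fin.forall_fin_succ, verticalPairEnd, map_arrowEnd]
  simp only [SignedArrowDiagram.IsBasedPair, SignedArrowDiagram.Joins, CyclicLT]
  grind

/-- With the base point on the arc ending at endpoint 3, the arrow `f 1` is met before `f 0`, hence
the exchanged roles in `IsBasedPair`. -/
theorem isBasedHom_verticalPair_iff' (G : SignedArrowDiagram ι P) (r l t : Bool) (f : Fin 3 → ι) :
    ((verticalPair r l t).rebase 3).IsBasedHom G.toArrowDiagram f ↔
      G.IsBasedPair l r (f 1) (f 0) ∧ G.Joins r l (f 0) (f 1) t (f 2) := by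
  rw [isBasedHom_rebase_iff (surjective_verticalPairEnd r l t) (pos_verticalPairEnd r l t)]
  simp [Fin.forall_fin_succ, verticalPairEnd, map_arrowEnd]
  simp only [SignedArrowDiagram.IsBasedPair, SignedArrowDiagram.Joins, CyclicLT]
  grind

/-- The arrows `a`, `b`, `c` are met in the order `a, a, b, b, c, c` along the circle. -/
def _root_.SignedArrowDiagram.IsDisjointTriple (G : SignedArrowDiagram ι P) (d e g : Bool)
    (a b c : ι) : Prop :=
  G.IsDisjointPair d e a b ∧
    CyclicLT (G.pos (arrowEnd d a)) (G.pos (arrowEnd (!e) b)) (G.pos (arrowEnd g c)) ∧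
    CyclicLT (G.pos (arrowEnd d a)) (G.pos (arrowEnd g c)) (G.pos (arrowEnd (!g) c))

theorem isHom_trianglePlus_iff (G : SignedArrowDiagram ι P) (d e g t : Bool) (f : Fin 4 → ι) :
    (trianglePlus d e g t).IsHom G.toArrowDiagram f ↔
      G.IsDisjointTriple d e g (f 0) (f 1) (f 2) ∧ G.Joins d e (f 0) (f 1) t (f 3) := by
  rw [isHom_iff (surjective_trianglePlusEnd d e g t) (pos_trianglePlusEnd d e g t)]
  simp [Fin.forall_fin_succ, trianglePlusEnd, map_arrowEnd]
  have := @CyclicLT.chain₆_iff _ _ (G.pos (arrowEnd d (f 0))) (G.pos (arrowEnd t (f 3)))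
    (G.pos (arrowEnd (!d) (f 0))) (G.pos (arrowEnd e (f 1))) (G.pos (arrowEnd (!t) (f 3)))
    (G.pos (arrowEnd (!e) (f 1)))
  simp only [SignedArrowDiagram.IsDisjointTriple, SignedArrowDiagram.IsDisjointPair,
    SignedArrowDiagram.Joins]
  tauto

/-- The arrows `f 0`, `f 1`, `f 2` are met from the base point in the same order as the first three
arrows of a `trianglePlus` with base point on the arc that ends at the endpoint `k`. -/
def _root_.SignedArrowDiagram.IsBasedTriple (G : SignedArrowDiagram ι P) (d e g : Bool)
    (f : Fin 3 → ι) (k : Fin 8) : Prop :=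
  (k = 0 → G.pos (arrowEnd d (f 0)) < G.pos (arrowEnd (!d) (f 0)) ∧
    G.pos (arrowEnd (!d) (f 0)) < G.pos (arrowEnd e (f 1)) ∧
    G.pos (arrowEnd e (f 1)) < G.pos (arrowEnd (!e) (f 1)) ∧
    G.pos (arrowEnd (!e) (f 1)) < G.pos (arrowEnd g (f 2)) ∧
    G.pos (arrowEnd g (f 2)) < G.pos (arrowEnd (!g) (f 2))) ∧
  (k = 3 → G.pos (arrowEnd e (f 1)) < G.pos (arrowEnd (!e) (f 1)) ∧
    G.pos (arrowEnd (!e) (f 1)) < G.pos (arrowEnd g (f 2)) ∧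
    G.pos (arrowEnd g (f 2)) < G.pos (arrowEnd (!g) (f 2)) ∧
    G.pos (arrowEnd (!g) (f 2)) < G.pos (arrowEnd d (f 0)) ∧
    G.pos (arrowEnd d (f 0)) < G.pos (arrowEnd (!d) (f 0))) ∧
  (k = 6 → G.pos (arrowEnd g (f 2)) < G.pos (arrowEnd (!g) (f 2)) ∧
    G.pos (arrowEnd (!g) (f 2)) < G.pos (arrowEnd d (f 0)) ∧
    G.pos (arrowEnd d (f 0)) < G.pos (arrowEnd (!d) (f 0)) ∧
    G.pos (arrowEnd (!d) (f 0)) < G.pos (arrowEnd e (f 1)) ∧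
    G.pos (arrowEnd e (f 1)) < G.pos (arrowEnd (!e) (f 1))) ∧
  (k = 7 → G.pos (arrowEnd (!g) (f 2)) < G.pos (arrowEnd d (f 0)) ∧
    G.pos (arrowEnd d (f 0)) < G.pos (arrowEnd (!d) (f 0)) ∧
    G.pos (arrowEnd (!d) (f 0)) < G.pos (arrowEnd e (f 1)) ∧
    G.pos (arrowEnd e (f 1)) < G.pos (arrowEnd (!e) (f 1)) ∧
    G.pos (arrowEnd (!e) (f 1)) < G.pos (arrowEnd g (f 2)))

/-- The arcs ending at endpoints 1, 2 and 4, 5 are those inside the arcs joined by the fourth arrow;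
the other four values of `k` remain. For these the base point never separates an end of that arrow
from the ends of the side around it. -/
theorem isBasedHom_trianglePlus_iff (G : SignedArrowDiagram ι P) (d e g t : Bool) (f : Fin 4 → ι)
    {k : Fin 8} (hk : k ∈ ({0, 3, 6, 7} : Finset (Fin 8))) :
    ((trianglePlus d e g t).rebase k).IsBasedHom G.toArrowDiagram f ↔
      G.IsBasedTriple d e g (fun i => f i.castSucc) k ∧ G.Joins d e (f 0) (f 1) t (f 3) := by
  rw [isBasedHom_rebase_iff (surjective_trianglePlusEnd d e g t) (pos_trianglePlusEnd d e g t)]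
  simp only [Finset.mem_insert, Finset.mem_singleton] at hk
  rcases hk with rfl | rfl | rfl | rfl
  all_goals
    simp [Fin.forall_fin_succ, trianglePlusEnd, map_arrowEnd, SignedArrowDiagram.IsBasedTriple]
    simp only [SignedArrowDiagram.Joins, CyclicLT]
    grind

theorem _root_.SignedArrowDiagram.IsBasedTriple.isDisjointPair {G : SignedArrowDiagram ι P}
    {d e g : Bool} {f : Fin 3 → ι} {k : Fin 8} (hk : k ∈ ({0, 3, 6, 7} : Finset (Fin 8)))
    (h : G.IsBasedTriple d e g f k) : G.IsDisjointPair d e (f 0) (f 1) := by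
  simp only [Finset.mem_insert, Finset.mem_singleton] at hk
  rcases hk with rfl | rfl | rfl | rfl
  all_goals
    simp [SignedArrowDiagram.IsBasedTriple] at h
    simp only [SignedArrowDiagram.IsDisjointPair, CyclicLT]
    grind

end ArrowDiagram

/-! ### The formulas with and without base point. -/

namespace SignedArrowDiagram.IsGaussDiagram

variable {ι P : Type*} [Fintype ι] [LinearOrder P] {Q : Type*} [LinearOrder Q]

theorem formula_eq {G : SignedArrowDiagram ι P} (hG : G.IsGaussDiagram) {n : ℕ}
    {A B : ArrowDiagram (Fin (n + 1)) Q} (C : (Fin n → ι) → Prop) (d e : Bool) (i j : Fin n)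
    (hC : ∀ f, C f → G.IsDisjointPair d e (f i) (f j))
    (hA : ∀ f, A.IsHom G.toArrowDiagram f ↔ C (fun k => f k.castSucc) ∧
      G.Joins d e (f i.castSucc) (f j.castSucc) true (f (Fin.last n)))
    (hB : ∀ f, B.IsHom G.toArrowDiagram f ↔ C (fun k => f k.castSucc) ∧
      G.Joins d e (f i.castSucc) (f j.castSucc) false (f (Fin.last n))) :
    A.formula G = B.formula G := by
  unfold ArrowDiagram.formula
  convert hG.sum_filter_eq C d e i j hC hA hB

theorem basedFormula_eq {G : SignedArrowDiagram ι P} (hG : G.IsGaussDiagram) {n : ℕ}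
    {A B : ArrowDiagram (Fin (n + 1)) Q} (C : (Fin n → ι) → Prop) (d e : Bool) (i j : Fin n)
    (hC : ∀ f, C f → G.IsDisjointPair d e (f i) (f j))
    (hA : ∀ f, A.IsBasedHom G.toArrowDiagram f ↔ C (fun k => f k.castSucc) ∧
      G.Joins d e (f i.castSucc) (f j.castSucc) true (f (Fin.last n)))
    (hB : ∀ f, B.IsBasedHom G.toArrowDiagram f ↔ C (fun k => f k.castSucc) ∧
      G.Joins d e (f i.castSucc) (f j.castSucc) false (f (Fin.last n))) :
    A.basedFormula G = B.basedFormula G := by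
  unfold ArrowDiagram.basedFormula
  convert hG.sum_filter_eq C d e i j hC hA hB

end SignedArrowDiagram.IsGaussDiagram

theorem mainTheorem2 {ι P : Type*} [Fintype ι] [LinearOrder P] (G : SignedArrowDiagram ι P)
    (hG : G.IsGaussDiagram) :
    -- first pair, without base point, and with base point on an arc between the vertical arrows
    (∀ right left : Bool,
      (ArrowDiagram.verticalPair right left true).formula G =
        (ArrowDiagram.verticalPair right left false).formula G ∧
      ∀ k ∈ ({0, 3} : Finset (Fin 6)),
        ((ArrowDiagram.verticalPair right left true).rebase k).basedFormula G =
          ((ArrowDiagram.verticalPair right left false).rebase k).basedFormula G) ∧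
    -- second pair, without base point, and with base point off the arcs joined by the fourth arrow
    (∀ side₀ side₁ side₂ : Bool,
      (ArrowDiagram.trianglePlus side₀ side₁ side₂ true).formula G =
        (ArrowDiagram.trianglePlus side₀ side₁ side₂ false).formula G ∧
      ∀ k ∈ ({0, 3, 6, 7} : Finset (Fin 8)),
        ((ArrowDiagram.trianglePlus side₀ side₁ side₂ true).rebase k).basedFormula G =
          ((ArrowDiagram.trianglePlus side₀ side₁ side₂ false).rebase k).basedFormula G) := by
  refine ⟨fun right left => ⟨?_, fun k hk => ?_⟩, fun side₀ side₁ side₂ => ⟨?_, fun k hk => ?_⟩⟩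
  · exact hG.formula_eq (fun f => G.IsDisjointPair right left (f 0) (f 1)) right left 0 1
      (fun f h => h) (ArrowDiagram.isHom_verticalPair_iff G right left true)
      (ArrowDiagram.isHom_verticalPair_iff G right left false)
  · simp only [Finset.mem_insert, Finset.mem_singleton] at hk
    rcases hk with rfl | rfl
    · exact hG.basedFormula_eq (fun f => G.IsBasedPair right left (f 0) (f 1)) right left 0 1
        (fun f h => h.isDisjointPair) (ArrowDiagram.isBasedHom_verticalPair_iff G right left true)
        (ArrowDiagram.isBasedHom_verticalPair_iff G right left false)
    · exact hG.basedFormula_eq (fun f => G.IsBasedPair left right (f 1) (f 0)) right left 0 1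
        (fun f h => h.isDisjointPair_swap)
        (ArrowDiagram.isBasedHom_verticalPair_iff' G right left true)
        (ArrowDiagram.isBasedHom_verticalPair_iff' G right left false)
  · exact hG.formula_eq (fun f => G.IsDisjointTriple side₀ side₁ side₂ (f 0) (f 1) (f 2))
      side₀ side₁ 0 1 (fun f h => h.1)
      (ArrowDiagram.isHom_trianglePlus_iff G side₀ side₁ side₂ true)
      (ArrowDiagram.isHom_trianglePlus_iff G side₀ side₁ side₂ false)
  · exact hG.basedFormula_eq (fun f => G.IsBasedTriple side₀ side₁ side₂ f k) side₀ side₁ 0 1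
      (fun f h => h.isDisjointPair hk)
      (fun f => ArrowDiagram.isBasedHom_trianglePlus_iff G side₀ side₁ side₂ true f hk)
      (fun f => ArrowDiagram.isBasedHom_trianglePlus_iff G side₀ side₁ side₂ false f hk)
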